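/- Let $\mathbf P_1,\mathbf P_2,\mathbf P_3\in\mathbb R^2$ be non-collinear points (for instance the vertices of an equilateral triangle of side length one), and let $m\ge 2$ be an integer. Let $T_1$ be the full triangle with vertices $\mathbf P_1,\mathbf P_2,\mathbf P_3$. Triangles are understood with labelled vertices. For a triangle $A$ with labelled vertices $\mathbf A_1,\mathbf A_2,\mathbf A_3$ let $P_A:\mathbb R^2\to\mathbb R^2$ be the affine map $\sum_i\alpha_i\mathbf P_i\mapsto\sum_i\alpha_i\mathbf A_i$ (where $\alpha_1+\alpha_2+\alpha_3=1$); for a triangle $B$ with vertices $\mathbf B_1,\mathbf B_2,\mathbf B_3$ let $P_A(B)$ be the triangle with vertices $P_A(\mathbf B_1),P_A(\mathbf B_2),P_A(\mathbf B_3)$. For $k=(k_1,k_2,k_3)\in\mathbb Z_{\ge0}^3$ let $T_m(k)$ be the triangle whose $i$-th vertex is $\frac1m\big(\mathbf P_i+\sum_j k_j\mathbf P_j\big)$, and let $T'_m(k)$ be the triangle whose $i$-th vertex is $\frac1m\big(\sum_{j\ne i}\mathbf P_j+\sum_j k_j\mathbf P_j\big)$. Put $\mathcal T_m=\{T_m(k):k_1+k_2+k_3=m-1\}$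 (upright triangles) and $\mathcal T'_m=\{T'_m(k):k_1+k_2+k_3=m-2\}$ (upside down triangles). An $m$-triangular patterns system is given by sets $\mathcal W,\mathcal Y\subseteq\mathcal T_m$ and $\mathcal W',\mathcal Y'\subseteq\mathcal T'_m$. The white triangles of level $n$ are defined by $\mathcal W_1=\mathcal W$, $\mathcal W'_1=\mathcal W'$ and, for $n\ge2$, $$\mathcal W_n=\{P_A(B):A\in\mathcal W_{n-1},B\in\mathcal W\}\cup\{P_A(B):A\in\mathcal W'_{n-1},B\in\mathcal Y'\},$$ $$\mathcal W'_n=\{P_A(B):A\in\mathcal W_{n-1},B\in\mathcal W'\}\cup\{P_A(B):A\in\mathcal W'_{n-1},B\in\mathcal Y\}.$$ The white fractal is $L^{\mathrm{white}}_\infty=\bigcap_{n\ge1}\bigcup_{T\in\mathcal W_n\cup\mathcal W'_n}T$. The yellow triangles of level $n$ and the yellow fractal $L^{\mathrm{yellow}}_\infty$ are obtained by exchanging the roles of $(\mathcal W,\mathcal W')$ and $(\mathcal Y,\mathcal Y')$. Let $\mathcal H$ be the directed multigraph with two vertices $\Omega,\Gamma$ that has one edge $\Omega\to\Omega$ for each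 element of $\mathcal W$, one edge $\Omega\to\Gamma$ for each element of $\mathcal W'$, one edge $\Gamma\to\Gamma$ for each element of $\mathcal Y$, and one edge $\Gamma\to\Omega$ for each element of $\mathcal Y'$. Associate with the edge labelled by the triangle $\Delta$ the map $P_\Delta$. **Proposition.** Suppose that $\mathcal W'$ and $\mathcal Y'$ are non-empty. Then: 1. Every map $P_\Delta$ is a similarity of ratio $1/m$, and the graph-directed iterated function system $\big(\mathcal H,(P_\Delta)\big)$ satisfies the open set condition: there are non-empty bounded open sets $U_\Omega,U_\Gamma\subset\mathbb R^2$ such that for each vertex $v$ the sets $P_\Delta(U_{w})$, over all edges $\Delta$ from $v$ to some vertex $w$, are pairwise disjoint subsets of $U_v$. 2. The pair $(L^{\mathrm{white}}_\infty,L^{\mathrm{yellow}}_\infty)$ is the attractor of this system, i.e. the unique pair of non-empty compact subsets of $\mathbb R^2$ with $$L^{\mathrm{white}}_\infty=\bigcup_{\Delta\in\mathcal W}P_\Delta(L^{\mathrm{white}}_\infty)\cup\bigcup_{\Delta\in\mathcal W'}P_\Delta(L^{\mathrm{yellow}}_\infty),\qquad L^{\mathrm{yellow}}_\infty=\bigcup_{\Delta\in\mathcal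 Y}P_\Delta(L^{\mathrm{yellow}}_\infty)\cup\bigcup_{\Delta\in\mathcal Y'}P_\Delta(L^{\mathrm{white}}_\infty).$$ 3. The box dimensions of the two fractals exist, and $$\dim_H L^{\mathrm{white}}_\infty=\dim_H L^{\mathrm{yellow}}_\infty=\dim_B L^{\mathrm{white}}_\infty=\dim_B L^{\mathrm{yellow}}_\infty=\frac{\log\lambda}{\log m},\qquad \lambda=\frac{|\mathcal W|+|\mathcal Y|+\sqrt{(|\mathcal W|-|\mathcal Y|)^2+4|\mathcal W'||\mathcal Y'|}}2 .$$ -/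

import Mathlib

open Set Filter Topology

noncomputable section

/-! ### Graph-directed iterated function systems -/

/-- The data of a graph-directed iterated function system on `X`: a directed multigraph with
vertices `V` and edges `E` (loops and parallel edges allowed), and a self-map of `X` for each edge.
The laws (contracting similarities, open set condition) are the predicates below. -/
structure GraphDirectedIFS (V E X : Type*) where
  src : E → V
  tgt : E → V
  map : E → X → X

namespace GraphDirectedIFS

variable {V E X : Type*}

/-- Every edge map is a similarity of ratio `r`, where `0 < r < 1`. -/
def IsSimilarWithRatio [PseudoMetricSpace X] (G : GraphDirectedIFS V E X) (r : ℝ) : Prop :=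
  0 < r ∧ r < 1 ∧ ∀ e x y, dist (G.map e x) (G.map e y) = r * dist x y

/-- A family of non-empty compact sets, one for each vertex, such that
`K v = ⋃ f_e (K (tgt e))`, the union being over the edges `e` that start in `v`. -/
def IsInvariantFamily [TopologicalSpace X] (G : GraphDirectedIFS V E X) (K : V → Set X) : Prop :=
  (∀ v, (K v).Nonempty ∧ IsCompact (K v)) ∧
    ∀ v, K v = ⋃ e ∈ {e | G.src e = v}, G.map e '' K (G.tgt e)

/-- The attractor: the unique invariant family of non-empty compact sets. -/
def IsAttractor [TopologicalSpace X] (G : GraphDirectedIFS V E X) (K : V → Set X) : Prop :=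
  G.IsInvariantFamily K ∧ ∀ K', G.IsInvariantFamily K' → K' = K

/-- The open set condition: there are non-empty bounded open sets `U v` such that, for every vertex
`v`, the images `f_e (U (tgt e))` over the edges `e` starting in `v` are pairwise disjoint subsets
of `U v`. -/
def OpenSetCondition [PseudoMetricSpace X] (G : GraphDirectedIFS V E X) : Prop :=
  ∃ U : V → Set X,
    (∀ v, IsOpen (U v) ∧ (U v).Nonempty ∧ Bornology.IsBounded (U v)) ∧
    (∀ e, G.map e '' U (G.tgt e) ⊆ U (G.src e)) ∧
    ∀ e e', G.src e = G.src e' → e ≠ e' →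
      Disjoint (G.map e '' U (G.tgt e)) (G.map e' '' U (G.tgt e'))

end GraphDirectedIFS

/-! ### Box dimension -/

/-- The non-empty, totally bounded set `A` has (lower and upper) box dimension `d`:
`log N_δ(A) / (-log δ) → d` as `δ → 0+`, where `N_δ(A)` is the least number of closed balls
of radius `δ` that cover `A`. -/
def HasBoxDim {X : Type*} [PseudoMetricSpace X] (A : Set X) (d : ℝ) : Prop :=
  A.Nonempty ∧ TotallyBounded A ∧
    Tendsto (fun δ : NNReal =>
        Real.log ((Metric.externalCoveringNumber δ A).toNat : ℝ) / (-Real.log (δ : ℝ)))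
      (𝓝[>] 0) (𝓝 d)

/-! ### Triangular patterns systems and their fractals -/

namespace TriangularLabyrinth

/-- The Euclidean plane. -/
abbrev Plane := EuclideanSpace ℝ (Fin 2)

/-- A triangle, given by its labelled vertices `A₁, A₂, A₃` (indexed by `0, 1, 2`). -/
abbrev Triangle := Fin 3 → Plane

/-- The full triangle `Δ(A₁, A₂, A₃)` as a set of points. -/
def Triangle.full (A : Triangle) : Set Plane := convexHull ℝ (range A)

variable (P : AffineBasis (Fin 3) ℝ Plane)

/-- The projection map `P_Δ` onto the triangle `A`:
`α₁ P₁ + α₂ P₂ + α₃ P₃ ↦ α₁ A₁ + α₂ A₂ + α₃ A₃`, where `α₁ + α₂ + α₃ = 1`.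
It is defined on the whole plane, not only on the triangle `T₁` spanned by `P₁, P₂, P₃`. -/
def proj (A : Triangle) (x : Plane) : Plane := ∑ i, P.coord i x • A i

/-- The triangle `P_A(B)`, with vertices `P_A(B₁), P_A(B₂), P_A(B₃)`. -/
def sub (A B : Triangle) : Triangle := fun i => proj P A (B i)

/-- `T_m(k₁, k₂, k₃)`: its `i`-th vertex is `(∑ j, (k_j + [j = i]) P_j) / m`. -/
def upright (m : ℕ) (k : Fin 3 → ℕ) : Triangle := fun i =>
  (m : ℝ)⁻¹ • ∑ j, ((k j : ℝ) + if j = i then 1 else 0) • P j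

/-- `T'_m(k₁, k₂, k₃)`: its `i`-th vertex is `(∑ j, (k_j + [j ≠ i]) P_j) / m`. -/
def upsideDown (m : ℕ) (k : Fin 3 → ℕ) : Triangle := fun i =>
  (m : ℝ)⁻¹ • ∑ j, ((k j : ℝ) + if j = i then 0 else 1) • P j

/-- The set `𝒯_m` of upright triangles: all `T_m(k)` with `k₁ + k₂ + k₃ = m - 1`. -/
def uprightTriangles (m : ℕ) : Set Triangle :=
  {T | ∃ k : Fin 3 → ℕ, ∑ i, k i + 1 = m ∧ T = upright P m k}

/-- The set `𝒯'_m` of upside down triangles: all `T'_m(k)` with `k₁ + k₂ + k₃ = m - 2`. -/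
def upsideDownTriangles (m : ℕ) : Set Triangle :=
  {T | ∃ k : Fin 3 → ℕ, ∑ i, k i + 2 = m ∧ T = upsideDown P m k}

/-- An `m`-triangular patterns system `(𝒲 ∪ 𝒲', 𝒴 ∪ 𝒴')`. -/
structure PatternsSystem (m : ℕ) where
  W : Finset Triangle
  W' : Finset Triangle
  Y : Finset Triangle
  Y' : Finset Triangle
  hW : ↑W ⊆ uprightTriangles P m
  hW' : ↑W' ⊆ upsideDownTriangles P m
  hY : ↑Y ⊆ uprightTriangles P m
  hY' : ↑Y' ⊆ upsideDownTriangles P m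

namespace PatternsSystem

variable {P} {m : ℕ}

/-- The system in which white and yellow are exchanged. -/
def swap (S : PatternsSystem P m) : PatternsSystem P m :=
  ⟨S.Y, S.Y', S.W, S.W', S.hY, S.hY', S.hW, S.hW'⟩

/-- `S.whiteLevel n` is the pair `(𝒲_{n+1}, 𝒲'_{n+1})`: level `1` is `(𝒲, 𝒲')`, and the next level
consists of the triangles `P_A(B)` with `A ∈ 𝒲_n`, `B ∈ 𝒲` or `A ∈ 𝒲'_n`, `B ∈ 𝒴'` (upright), and
with `A ∈ 𝒲_n`, `B ∈ 𝒲'` or `A ∈ 𝒲'_n`, `B ∈ 𝒴` (upside down). -/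
def whiteLevel (S : PatternsSystem P m) : ℕ → Set Triangle × Set Triangle
  | 0 => (↑S.W, ↑S.W')
  | n + 1 =>
    (image2 (sub P) (S.whiteLevel n).1 ↑S.W ∪ image2 (sub P) (S.whiteLevel n).2 ↑S.Y',
      image2 (sub P) (S.whiteLevel n).1 ↑S.W' ∪ image2 (sub P) (S.whiteLevel n).2 ↑S.Y)

/-- The white fractal: the intersection over all levels `n ≥ 1` of the union of the white triangles
of level `n`. -/
def whiteFractal (S : PatternsSystem P m) : Set Plane :=
  ⋂ n : ℕ, ⋃ T ∈ (S.whiteLevel n).1 ∪ (S.whiteLevel n).2, Triangle.full T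

/-- The yellow fractal: the same construction with white and yellow exchanged. -/
def yellowFractal (S : PatternsSystem P m) : Set Plane := S.swap.whiteFractal

/-- The two vertices of the directed multigraph. -/
inductive Vertex
  | white
  | yellow

/-- The edges of the directed multigraph, one for each triangle of the patterns system. -/
inductive Edge (S : PatternsSystem P m)
  | ofW (T : S.W)
  | ofW' (T : S.W')
  | ofY (T : S.Y)
  | ofY' (T : S.Y')

/-- The graph-directed iterated function system of `S`: `𝒲` gives loops at `white`, `𝒲'` edges from
`white` to `yellow`, `𝒴` loops at `yellow`, `𝒴'` edges from `yellow` to `white`; the map of the edge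
labelled by the triangle `T` is `P_T`. -/
def gifs (S : PatternsSystem P m) : GraphDirectedIFS Vertex (Edge S) Plane where
  src
    | .ofW _ => .white
    | .ofW' _ => .white
    | .ofY _ => .yellow
    | .ofY' _ => .yellow
  tgt
    | .ofW _ => .white
    | .ofW' _ => .yellow
    | .ofY _ => .yellow
    | .ofY' _ => .white
  map
    | .ofW T => proj P T
    | .ofW' T => proj P T
    | .ofY T => proj P T
    | .ofY' T => proj P T

/-- The pair (white fractal, yellow fractal), as a family indexed by the vertices. -/
def fractals (S : PatternsSystem P m) : Vertex → Set Plane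
  | .white => S.whiteFractal
  | .yellow => S.yellowFractal

/-- `λ = (|𝒲| + |𝒴| + √((|𝒲| - |𝒴|)² + 4 |𝒲'| |𝒴'|)) / 2`. -/
def growthRate (S : PatternsSystem P m) : ℝ :=
  ((S.W.card : ℝ) + S.Y.card +
    √(((S.W.card : ℝ) - S.Y.card) ^ 2 + 4 * S.W'.card * S.Y'.card)) / 2

end PatternsSystem

end TriangularLabyrinth

end

/-! In barycentric coordinates `P_T` is `x ↦ (k + x)/m` for an upright `T` and `x ↦ (k + 1 - x)/m`
for an upside down one: a homothety, possibly composed with a point reflection, hence a similarity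
of ratio `1/m` for every shape of the base triangle. On the open base triangle all coordinates lie
in `(0,1)`, so an image point determines `k` as integer parts. The sum of `k` tells upright from
upside down, and the open triangle serves at both vertices in the open set condition.

The levels are defined by appending a last letter, the set equations by removing a first one.
Associativity of `sub` reconciles the two (`whiteLevel_succ_eq`), with an upside down first letter
exchanging the colours. The fractals are thus nested intersections of level sets; compactness and a
pigeonhole argument on first edges give invariance, contraction gives uniqueness.

For the dimension, `λ` is an eigenvalue of the edge-counting matrix with a positive eigenvector `h`.
Giving weight `h w / λ ^ n` to a level-`n` cell ending at `w` makes total weight invariant under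
subdivision. Counting cells by weight bounds covering numbers from above
(`exists_ballCoverUpperBound`). Conversely, disjoint open cells and a volume comparison show that a
set of diameter at most `r ^ n` meets cells of total weight at most a constant times `λ ^ (-n)`.
This is a mass distribution principle with finite-level weights replacing a limit measure
(`exists_finiteCoverLowerBound`). The two bounds determine both dimensions. -/

noncomputable section

namespace GraphDirectedIFS

variable {V E X : Type*}

/-! ### Existence and uniqueness of the attractor -/

theorem IsSimilarWithRatio.injective [MetricSpace X] {G : GraphDirectedIFS V E X} {r : ℝ}
    (hr : G.IsSimilarWithRatio r) (e : E) : Function.Injective (G.map e) := by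
  intro x y hxy
  have h := hr.2.2 e x y
  rw [hxy, dist_self, eq_comm, mul_eq_zero] at h
  exact dist_eq_zero.1 (h.resolve_left hr.1.ne')

theorem IsSimilarWithRatio.lipschitzWith [PseudoMetricSpace X] {G : GraphDirectedIFS V E X} {r : ℝ}
    (hr : G.IsSimilarWithRatio r) (e : E) : LipschitzWith r.toNNReal (G.map e) :=
  LipschitzWith.of_dist_le_mul fun x y => by
    rw [Real.coe_toNNReal r hr.1.le, hr.2.2]

theorem IsSimilarWithRatio.antilipschitzWith [PseudoMetricSpace X] {G : GraphDirectedIFS V E X}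
    {r : ℝ} (hr : G.IsSimilarWithRatio r) (e : E) : AntilipschitzWith r⁻¹.toNNReal (G.map e) :=
  AntilipschitzWith.of_le_mul_dist fun x y => by
    rw [Real.coe_toNNReal r⁻¹ (inv_nonneg.2 hr.1.le), hr.2.2, inv_mul_cancel_left₀ hr.1.ne']

theorem IsInvariantFamily.image_subset [TopologicalSpace X] {G : GraphDirectedIFS V E X}
    {K : V → Set X} (hK : G.IsInvariantFamily K) (e : E) :
    G.map e '' K (G.tgt e) ⊆ K (G.src e) := by
  rw [hK.2 (G.src e)]
  exact subset_biUnion_of_mem (u := fun e => G.map e '' K (G.tgt e)) (show e ∈ {e' | G.src e' = G.src e} from rfl)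

theorem IsInvariantFamily.exists_edge [TopologicalSpace X] {G : GraphDirectedIFS V E X}
    {K : V → Set X} (hK : G.IsInvariantFamily K) {v : V} {x : X} (hx : x ∈ K v) :
    ∃ e, G.src e = v ∧ ∃ y ∈ K (G.tgt e), G.map e y = x := by
  rw [hK.2 v] at hx
  simpa using hx

/-- Following `n` edges from a point of `K v` and applying the same maps to a point of `K'` gives a
point of `K' v` at distance at most `D * r ^ n`; closedness of `K' v` finishes. -/
theorem IsInvariantFamily.subset [MetricSpace X] [Finite V] {G : GraphDirectedIFS V E X} {r : ℝ}
    (hr : G.IsSimilarWithRatio r) {K K' : V → Set X} (hK : G.IsInvariantFamily K)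
    (hK' : G.IsInvariantFamily K') (v : V) : K v ⊆ K' v := by
  have hb : Bornology.IsBounded (⋃ v, K v ∪ K' v) :=
    Bornology.isBounded_iUnion.2 fun v => ((hK.1 v).2.union (hK'.1 v).2).isBounded
  obtain ⟨D, hD⟩ := Metric.isBounded_iff.1 hb
  have key : ∀ (n : ℕ) (v : V), ∀ x ∈ K v, ∃ y ∈ K' v, dist x y ≤ D * r ^ n := by
    intro n
    induction n with
    | zero =>
      intro v x hx
      obtain ⟨y, hy⟩ := (hK'.1 v).1
      refine ⟨y, hy, ?_⟩
      rw [pow_zero, mul_one]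
      exact hD (mem_iUnion.2 ⟨v, Or.inl hx⟩) (mem_iUnion.2 ⟨v, Or.inr hy⟩)
    | succ n ih =>
      intro v x hx
      obtain ⟨e, rfl, z, hz, rfl⟩ := hK.exists_edge hx
      obtain ⟨y, hy, hzy⟩ := ih _ z hz
      refine ⟨G.map e y, hK'.image_subset e (mem_image_of_mem _ hy), ?_⟩
      rw [hr.2.2, pow_succ]
      nlinarith [mul_le_mul_of_nonneg_left hzy hr.1.le]
  intro x hx
  rw [← (hK'.1 v).2.isClosed.closure_eq, Metric.mem_closure_iff]
  intro ε hε
  have hlim : Tendsto (fun n : ℕ => D * r ^ n) atTop (𝓝 0) := by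
    simpa using (tendsto_pow_atTop_nhds_zero_of_lt_one hr.1.le hr.2.1).const_mul D
  obtain ⟨n, hn⟩ := (hlim.eventually (gt_mem_nhds hε)).exists
  obtain ⟨y, hy, hxy⟩ := key n v x hx
  exact ⟨y, hy, hxy.trans_lt hn⟩

theorem IsInvariantFamily.isAttractor [MetricSpace X] [Finite V] {G : GraphDirectedIFS V E X}
    {r : ℝ} (hr : G.IsSimilarWithRatio r) {K : V → Set X} (hK : G.IsInvariantFamily K) :
    G.IsAttractor K :=
  ⟨hK, fun _ hK' => funext fun v =>
    (IsInvariantFamily.subset hr hK' hK v).antisymm (IsInvariantFamily.subset hr hK hK' v)⟩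

/-- `G.levelSet T n v` is the union of the images of `T` under the compositions of the maps along
the paths of length `n` that start in `v`. -/
def levelSet (G : GraphDirectedIFS V E X) (T : Set X) : ℕ → V → Set X
  | 0, _ => T
  | n + 1, v => ⋃ e ∈ {e | G.src e = v}, G.map e '' levelSet G T n (G.tgt e)

theorem mem_levelSet_succ {G : GraphDirectedIFS V E X} {T : Set X} {n : ℕ} {v : V} {x : X} :
    x ∈ G.levelSet T (n + 1) v ↔
      ∃ e, G.src e = v ∧ ∃ y ∈ G.levelSet T n (G.tgt e), G.map e y = x := by
  simp [levelSet]

theorem levelSet_antitone {G : GraphDirectedIFS V E X} {T : Set X}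
    (hT : ∀ e, G.map e '' T ⊆ T) (v : V) : Antitone fun n => G.levelSet T n v := by
  refine antitone_nat_of_succ_le fun n => ?_
  induction n generalizing v with
  | zero => exact iUnion₂_subset fun e _ => hT e
  | succ n ih => exact iUnion₂_mono fun e _ => image_mono (ih _)

theorem isInvariantFamily_iInter_levelSet [TopologicalSpace X] [T2Space X] [Finite E]
    {G : GraphDirectedIFS V E X} {T : Set X} (hc : IsCompact T) (hne : T.Nonempty)
    (hcont : ∀ e, Continuous (G.map e)) (hinj : ∀ e, Function.Injective (G.map e))
    (hT : ∀ e, G.map e '' T ⊆ T) (hout : ∀ v, ∃ e, G.src e = v) :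
    G.IsInvariantFamily fun v => ⋂ n, G.levelSet T n v := by
  have hcomp : ∀ n v, IsCompact (G.levelSet T n v) := by
    intro n
    induction n with
    | zero => exact fun _ => hc
    | succ n ih =>
      exact fun v => (Set.toFinite _).isCompact_biUnion fun e _ => (ih _).image (hcont e)
  have hnon : ∀ n v, (G.levelSet T n v).Nonempty := by
    intro n
    induction n with
    | zero => exact fun _ => hne
    | succ n ih =>
      intro v
      obtain ⟨e, he⟩ := hout v
      obtain ⟨y, hy⟩ := ih (G.tgt e)
      exact ⟨_, mem_levelSet_succ.2 ⟨e, he, y, hy, rfl⟩⟩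
  refine ⟨fun v => ⟨?_, ?_⟩, fun v => ?_⟩
  · exact IsCompact.nonempty_iInter_of_sequence_nonempty_isCompact_isClosed _
      (fun n => levelSet_antitone hT v n.le_succ) (fun n => hnon n v) (hcomp 0 v)
      fun n => (hcomp n v).isClosed
  · exact (hcomp 0 v).of_isClosed_subset (isClosed_iInter fun n => (hcomp n v).isClosed)
      (iInter_subset _ 0)
  · ext x
    constructor
    · intro hx
      have h1 : ∀ n, ∃ e, G.src e = v ∧ ∃ y ∈ G.levelSet T n (G.tgt e), G.map e y = x :=
        fun n => mem_levelSet_succ.1 (mem_iInter.1 hx (n + 1))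
      choose e he y hy hyx using h1
      -- The first edge may depend on the level, but one edge recurs infinitely often. By
      -- injectivity its preimages of `x` coincide, and nestedness puts the common preimage in every
      -- level set.
      obtain ⟨e₀, he₀⟩ := Finite.exists_infinite_fiber e
      have hfreq : ∀ n, ∃ k, n ≤ k ∧ e k = e₀ := by
        intro n
        obtain ⟨k, hk, hnk⟩ := (Set.infinite_coe_iff.1 he₀).exists_gt n
        exact ⟨k, hnk.le, hk⟩
      obtain ⟨k₀, -, hk₀⟩ := hfreq 0
      refine mem_iUnion₂.2 ⟨e₀, hk₀ ▸ he k₀, y k₀, mem_iInter.2 fun n => ?_, hk₀ ▸ hyx k₀⟩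
      obtain ⟨k, hnk, hk⟩ := hfreq n
      have hyy : y k₀ = y k := hinj e₀ (by rw [← hk₀, hyx k₀, hk₀, ← hk, hyx k])
      rw [hyy]
      exact levelSet_antitone hT _ hnk (hk ▸ hy k)
    · intro hx
      obtain ⟨e, he, y, hy, rfl⟩ := mem_iUnion₂.1 hx
      refine mem_iInter.2 fun n => levelSet_antitone hT v n.le_succ ?_
      exact mem_levelSet_succ.2 ⟨e, he, y, mem_iInter.1 hy n, rfl⟩

end GraphDirectedIFS

/-! ### Dimensions from bounds for finite covers -/

section CoverBounds

open MeasureTheory Metric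
open scoped ENNReal NNReal

variable {X : Type*}

/-- Every finite cover of `A` by sets of diameters at most `δᵢ ≤ 1` has `∑ δᵢ ^ s ≥ c`. -/
def FiniteCoverLowerBound [PseudoMetricSpace X] (A : Set X) (s c : ℝ) : Prop :=
  ∀ F : Finset (Set X × ℝ),
    (∀ p ∈ F, 0 < p.2 ∧ p.2 ≤ 1 ∧ ∀ x ∈ p.1, ∀ y ∈ p.1, dist x y ≤ p.2) →
    A ⊆ ⋃ p ∈ F, p.1 → c ≤ ∑ p ∈ F, p.2 ^ s

/-- For `0 < δ ≤ 1`, the set `A` is covered by at most `C δ ^ (-s)` closed balls of radius `δ`. -/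
def BallCoverUpperBound [PseudoMetricSpace X] (A : Set X) (s C : ℝ) : Prop :=
  ∀ δ : ℝ, 0 < δ → δ ≤ 1 →
    ∃ t : Finset X, A ⊆ ⋃ x ∈ t, closedBall x δ ∧ (t.card : ℝ) ≤ C * δ ^ (-s)

/-- The balls of radius `1/(n+1)` have `s`-sums at most `C * 2 ^ s` for all `n`, so the
`s`-dimensional Hausdorff measure is finite. -/
theorem BallCoverUpperBound.dimH_le [MetricSpace X] {A : Set X} {s C : ℝ} (hs : 0 ≤ s)
    (h : BallCoverUpperBound A s C) : dimH A ≤ ENNReal.ofReal s := by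
  borelize X
  have hδ : ∀ n : ℕ, 0 < 1 / ((n : ℝ) + 1) ∧ 1 / ((n : ℝ) + 1) ≤ 1 := fun n =>
    ⟨by positivity, by rw [div_le_one (by positivity)]; linarith [n.cast_nonneg (α := ℝ)]⟩
  choose t ht hcard using fun n : ℕ => h _ (hδ n).1 (hδ n).2
  have hle : μH[s] A ≤ ENNReal.ofReal (C * 2 ^ s) := by
    refine (Measure.hausdorffMeasure_le_liminf_sum (ι := fun n => t n) s A (l := atTop)
      (fun n : ℕ => ENNReal.ofReal (2 * (1 / ((n : ℝ) + 1)))) ?_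
      (fun n x => closedBall x (1 / ((n : ℝ) + 1))) ?_ ?_).trans ?_
    · have h0 := (tendsto_one_div_add_atTop_nhds_zero_nat (𝕜 := ℝ)).const_mul 2
      simpa using ENNReal.tendsto_ofReal h0
    · refine Eventually.of_forall fun n x => ?_
      refine ediam_le_of_forall_dist_le fun y hy z hz => ?_
      have := dist_triangle_right y z x
      rw [mem_closedBall] at hy hz
      linarith
    · refine Eventually.of_forall fun n x hx => ?_
      obtain ⟨y, hy, hxy⟩ := mem_iUnion₂.1 (ht n hx)
      exact mem_iUnion.2 ⟨⟨y, hy⟩, hxy⟩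
    · refine liminf_le_of_frequently_le' (Frequently.of_forall fun n => ?_)
      have hd : ∀ x : t n, ediam (closedBall (x : X) (1 / ((n : ℝ) + 1))) ^ s
          ≤ ENNReal.ofReal ((2 * (1 / ((n : ℝ) + 1))) ^ s) := by
        intro x
        rw [← ENNReal.ofReal_rpow_of_nonneg (by positivity) hs]
        refine ENNReal.rpow_le_rpow ?_ hs
        refine ediam_le_of_forall_dist_le fun y hy z hz => ?_
        have := dist_triangle_right y z (x : X)
        rw [mem_closedBall] at hy hz
        linarith
      refine (Finset.sum_le_sum fun x _ => hd x).trans ?_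
      rw [Finset.sum_const, nsmul_eq_mul, Finset.card_univ, Fintype.card_coe,
        ← ENNReal.ofReal_natCast, ← ENNReal.ofReal_mul (by positivity)]
      refine ENNReal.ofReal_le_ofReal ?_
      calc ((t n).card : ℝ) * (2 * (1 / ((n : ℝ) + 1))) ^ s
          ≤ (C * (1 / ((n : ℝ) + 1)) ^ (-s)) * (2 * (1 / ((n : ℝ) + 1))) ^ s := by
            gcongr
            exact hcard n
        _ = C * 2 ^ s := by
            rw [Real.mul_rpow (by norm_num) (hδ n).1.le, Real.rpow_neg (hδ n).1.le]
            have : (1 / ((n : ℝ) + 1)) ^ s ≠ 0 := (Real.rpow_pos_of_pos (hδ n).1 s).ne'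
            field_simp
  have := dimH_le_of_hausdorffMeasure_ne_top (s := A) (d := s.toNNReal) (by
    rw [Real.coe_toNNReal s hs]
    exact ne_top_of_le_ne_top ENNReal.ofReal_ne_top hle)
  exact this

/-- If the Hausdorff measure vanished, there would be a countable cover with arbitrarily small
`s`-sum; slightly enlarged to open sets, it has a finite subcover by compactness, against the lower
bound. -/
theorem FiniteCoverLowerBound.le_dimH [MetricSpace X] {A : Set X} (hA : IsCompact A) {s c : ℝ}
    (hc : 0 < c) (h : FiniteCoverLowerBound A s c) : ENNReal.ofReal s ≤ dimH A := by
  borelize X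
  rcases le_or_gt s 0 with hs | hs
  · simp [ENNReal.ofReal_of_nonpos hs]
  refine le_dimH_of_hausdorffMeasure_ne_zero (s := A) (d := s.toNNReal) ?_
  rw [Real.coe_toNNReal s hs.le]
  intro h0
  rw [Measure.hausdorffMeasure_apply] at h0
  -- Scale `1/2` leaves room to enlarge the sets while keeping diameters at most `1`.
  have h1 := (iSup₂_le_iff.1 h0.le) (ENNReal.ofReal (1 / 2)) (by simp)
  have h2 := lt_of_le_of_lt h1 (ENNReal.ofReal_pos.2 (half_pos hc))
  simp only [iInf_lt_iff] at h2
  obtain ⟨t, htA, htd, htsum⟩ := h2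
  set a : ℕ → ℝ := fun n => (ediam (t n)).toReal with ha
  have hne : ∀ n, ediam (t n) ≠ ∞ := fun n => ne_top_of_le_ne_top ENNReal.ofReal_ne_top (htd n)
  have ha0 : ∀ n, 0 ≤ a n := fun n => ENNReal.toReal_nonneg
  have ha2 : ∀ n, a n ≤ 1 / 2 := fun n =>
    ENNReal.toReal_le_of_le_ofReal (by norm_num) (htd n)
  -- The errors `c / 4 * (1 / 2) ^ n` add up to `c / 2`. Strictness of `a n < d` also handles sets
  -- of diameter zero.
  have hd : ∀ n, ∃ d, a n < d ∧ d ≤ 1 ∧ d ^ s < a n ^ s + c / 4 * (1 / 2) ^ n := by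
    intro n
    have hcont : ContinuousAt (fun x : ℝ => x ^ s) (a n) :=
      Real.continuousAt_rpow_const _ _ (Or.inr hs.le)
    have hev : ∀ᶠ d in 𝓝 (a n), d ^ s < a n ^ s + c / 4 * (1 / 2) ^ n :=
      hcont.eventually (gt_mem_nhds (lt_add_of_pos_right _ (by positivity)))
    have hev1 : ∀ᶠ d in 𝓝 (a n), d < 1 := gt_mem_nhds (by linarith [ha2 n])
    have := ((hev.and hev1).filter_mono nhdsWithin_le_nhds).and
      (self_mem_nhdsWithin (a := a n) (s := Ioi (a n)))
    obtain ⟨d, ⟨h1, h2⟩, h3⟩ := this.exists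
    exact ⟨d, h3, h2.le, h1⟩
  choose d hda hd1 hds using hd
  set U : ℕ → Set X := fun n => thickening ((d n - a n) / 2) (t n) with hU
  have hUd : ∀ n, ∀ x ∈ U n, ∀ y ∈ U n, dist x y ≤ d n := by
    intro n x hx y hy
    obtain ⟨x', hx', hxx⟩ := mem_thickening_iff.1 hx
    obtain ⟨y', hy', hyy⟩ := mem_thickening_iff.1 hy
    have h1 : dist x' y' ≤ a n := by
      rw [ha, dist_edist]
      exact ENNReal.toReal_mono (hne n) (edist_le_ediam_of_mem hx' hy')
    have h2 := dist_triangle4 x x' y' y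
    rw [dist_comm y' y] at h2
    linarith
  obtain ⟨F, hF⟩ := hA.elim_finite_subcover U (fun n => isOpen_thickening)
    (htA.trans (iUnion_mono fun n => self_subset_thickening (by linarith [hda n]) _))
  have key := h (F.image fun n => (U n, d n)) (by
      simp only [Finset.mem_image, forall_exists_index, and_imp]
      rintro p n - rfl
      exact ⟨(ha0 n).trans_lt (hda n), hd1 n, hUd n⟩) (by
      intro x hx
      obtain ⟨n, hn, hxn⟩ := mem_iUnion₂.1 (hF hx)
      exact mem_iUnion₂.2 ⟨(U n, d n), Finset.mem_image_of_mem _ hn, hxn⟩)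
  have hsum1 : ∑ p ∈ F.image (fun n => (U n, d n)), p.2 ^ s ≤ ∑ n ∈ F, d n ^ s :=
    Finset.sum_image_le_of_nonneg (f := fun p : Set X × ℝ => p.2 ^ s) <| by
      simp only [Finset.mem_image, forall_exists_index, and_imp]
      rintro p n - rfl
      exact Real.rpow_nonneg ((ha0 n).trans (hda n).le) s
  have hsum2 : ∑ n ∈ F, d n ^ s ≤ ∑ n ∈ F, a n ^ s + ∑ n ∈ F, c / 4 * (1 / 2) ^ n := by
    rw [← Finset.sum_add_distrib]
    exact Finset.sum_le_sum fun n _ => (hds n).le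
  have hsum3 : ∑ n ∈ F, c / 4 * (1 / 2 : ℝ) ^ n ≤ c / 2 := by
    have hsm := summable_geometric_two.mul_left (c / 4)
    refine (hsm.sum_le_tsum F fun n _ => by positivity).trans ?_
    rw [tsum_mul_left, tsum_geometric_two]
    linarith
  have hsum4 : ∑ n ∈ F, a n ^ s < c / 2 := by
    have h3 : ENNReal.ofReal (∑ n ∈ F, a n ^ s) < ENNReal.ofReal (c / 2) := by
      refine lt_of_le_of_lt ?_ htsum
      refine le_trans ?_ (ENNReal.sum_le_tsum F)
      rw [ENNReal.ofReal_sum_of_nonneg fun n _ => Real.rpow_nonneg (ha0 n) s]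
      refine Finset.sum_le_sum fun n _ => ?_
      rw [← ENNReal.ofReal_rpow_of_nonneg (ha0 n) hs.le, ha, ENNReal.ofReal_toReal (hne n)]
      -- An empty set contributes `0` to the Hausdorff sum, which agrees with `0 ^ s` because `s >
      -- 0`.
      rcases (t n).eq_empty_or_nonempty with he | he
      · simp [he, hs]
      · exact le_iSup (fun _ : (t n).Nonempty => ediam (t n) ^ s) he
    exact (ENNReal.ofReal_lt_ofReal_iff (half_pos hc)).1 h3
  linarith

theorem exists_finset_card_eq_externalCoveringNumber [PseudoMetricSpace X] {A : Set X} {δ : ℝ≥0}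
    (h : externalCoveringNumber δ A ≠ ⊤) :
    ∃ t : Finset X, IsCover δ A (t : Set X) ∧ (t.card : ℕ∞) = externalCoveringNumber δ A := by
  have : Nonempty {C : Set X // IsCover δ A C} := ⟨⟨A, .rfl⟩⟩
  obtain ⟨C, hC⟩ := ENat.exists_eq_iInf fun C : {C : Set X // IsCover δ A C} => (C : Set X).encard
  rw [iInf_subtype] at hC
  have hfin : (C : Set X).Finite := Set.encard_ne_top_iff.1 (hC ▸ h)
  refine ⟨hfin.toFinset, by simpa using C.2, ?_⟩
  rw [← hfin.encard_eq_coe_toFinset_card, hC]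
  rfl

/-- Both bounds have the form `k * δ ^ (-s)`, so the logarithmic quotient is squeezed between terms
`log k / (-log δ) + s`. -/
theorem hasBoxDim_of_cover_bounds [PseudoMetricSpace X] {A : Set X} (hA : TotallyBounded A)
    (hne : A.Nonempty) {s c C : ℝ} (hc : 0 < c) (hlow : FiniteCoverLowerBound A s c)
    (hup : BallCoverUpperBound A s C) : HasBoxDim A s := by
  refine ⟨hne, hA, ?_⟩
  have hC : 0 < C := by
    obtain ⟨t, ht, hcard⟩ := hup 1 one_pos le_rfl
    obtain ⟨x, hx⟩ := hne
    obtain ⟨y, hy, -⟩ := mem_iUnion₂.1 (ht hx)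
    have h1 : (1 : ℝ) ≤ t.card := by exact_mod_cast Finset.card_pos.2 ⟨y, hy⟩
    rw [Real.one_rpow, mul_one] at hcard
    linarith
  set N : ℝ≥0 → ℝ := fun δ => ((externalCoveringNumber δ A).toNat : ℝ) with hN
  have hle : ∀ δ : ℝ≥0, 0 < δ → δ ≤ 1 → externalCoveringNumber δ A ≠ ⊤ ∧
      N δ ≤ C * (δ : ℝ) ^ (-s) := by
    intro δ h0 h1
    obtain ⟨t, ht, hcard⟩ := hup δ h0 h1
    have hcov : externalCoveringNumber δ A ≤ t.card := by
      have := (isCover_iff_subset_iUnion_closedBall.2 ht :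
        IsCover δ A (t : Set X)).externalCoveringNumber_le_encard
      rwa [Set.encard_coe_eq_coe_finsetCard] at this
    refine ⟨ne_top_of_le_ne_top (ENat.natCast_ne_top _) hcov, le_trans ?_ hcard⟩
    exact Nat.cast_le.2 (ENat.toNat_le_of_le_natCast hcov)
  -- Balls of radius `δ` have diameter up to `2 * δ`, which must not exceed `1`.
  have hge : ∀ δ : ℝ≥0, 0 < δ → δ ≤ 1 / 2 → c * 2 ^ (-s) * (δ : ℝ) ^ (-s) ≤ N δ := by
    intro δ h0 h1
    have h1' : (δ : ℝ) ≤ 1 / 2 := by exact_mod_cast h1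
    have h0' : (0 : ℝ) < δ := h0
    have hfin := (hle δ h0 (h1.trans (by rw [div_le_one] <;> norm_num))).1
    obtain ⟨t, ht, hcard⟩ := exists_finset_card_eq_externalCoveringNumber hfin
    have key := hlow (t.image fun x => (closedBall x δ, 2 * (δ : ℝ))) (by
        simp only [Finset.mem_image, forall_exists_index, and_imp]
        rintro p x - rfl
        refine ⟨by positivity, by linarith, fun y hy z hz => ?_⟩
        have := dist_triangle_right y z x
        rw [mem_closedBall] at hy hz
        linarith) (by
        intro y hy
        obtain ⟨x, hx, hxy⟩ := mem_iUnion₂.1 (isCover_iff_subset_iUnion_closedBall.1 ht hy)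
        exact mem_iUnion₂.2 ⟨_, Finset.mem_image_of_mem _ hx, hxy⟩)
    have hsum : ∑ p ∈ t.image (fun x => (closedBall x δ, 2 * (δ : ℝ))), p.2 ^ s
        ≤ ∑ x ∈ t, (2 * (δ : ℝ)) ^ s :=
      Finset.sum_image_le_of_nonneg (f := fun p : Set X × ℝ => p.2 ^ s) <| by
        simp only [Finset.mem_image, forall_exists_index, and_imp]
        rintro p n - rfl
        positivity
    rw [Finset.sum_const, nsmul_eq_mul] at hsum
    have hN : N δ = t.card := by rw [hN]; simp only [← hcard, ENat.toNat_natCast]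
    rw [hN, mul_assoc, ← Real.mul_rpow (by norm_num) h0'.le, Real.rpow_neg (by positivity),
      ← div_eq_mul_inv, div_le_iff₀ (by positivity)]
    exact key.trans hsum
  have hL : Tendsto (fun δ : ℝ≥0 => -Real.log (δ : ℝ)) (𝓝[>] 0) atTop := by
    refine tendsto_neg_atBot_atTop.comp (Real.tendsto_log_nhdsGT_zero.comp ?_)
    refine tendsto_nhdsWithin_iff.2 ⟨?_, ?_⟩
    · exact (NNReal.continuous_coe.tendsto' 0 0 rfl).mono_left nhdsWithin_le_nhds
    · filter_upwards [self_mem_nhdsWithin] with δ hδ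
      exact hδ
  have hlim : ∀ k : ℝ, Tendsto (fun δ : ℝ≥0 => k / -Real.log (δ : ℝ) + s) (𝓝[>] 0) (𝓝 s) := by
    intro k
    simpa using (hL.const_div_atTop k).add_const s
  have hsmall : ∀ᶠ δ : ℝ≥0 in 𝓝[>] 0, 0 < δ ∧ δ ≤ 1 / 2 := by
    filter_upwards [self_mem_nhdsWithin, nhdsWithin_le_nhds (Iic_mem_nhds
      (show (0 : ℝ≥0) < 1 / 2 by positivity))] with δ h1 h2
    exact ⟨h1, h2⟩
  have hlog : ∀ δ : ℝ≥0, 0 < δ → δ ≤ 1 / 2 → 0 < -Real.log (δ : ℝ) := by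
    intro δ h0 h1
    have h1' : (δ : ℝ) ≤ 1 / 2 := by exact_mod_cast h1
    exact neg_pos.2 (Real.log_neg (by exact_mod_cast h0) (by linarith))
  have hk : ∀ (k : ℝ) (δ : ℝ≥0), 0 < k → 0 < δ → δ ≤ 1 / 2 →
      Real.log (k * (δ : ℝ) ^ (-s)) / -Real.log (δ : ℝ)
        = Real.log k / -Real.log (δ : ℝ) + s := by
    intro k δ hk h0 h1
    have h0' : (0 : ℝ) < δ := h0
    rw [Real.log_mul hk.ne' (by positivity), Real.log_rpow h0']
    have := neg_ne_zero.1 (hlog δ h0 h1).ne'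
    field_simp
    ring
  refine tendsto_of_tendsto_of_tendsto_of_le_of_le' (hlim (Real.log (c * 2 ^ (-s))))
    (hlim (Real.log C)) ?_ ?_
  · filter_upwards [hsmall] with δ hδ
    have h0' : (0 : ℝ) < δ := hδ.1
    rw [← hk _ δ (by positivity) hδ.1 hδ.2]
    have := (hlog δ hδ.1 hδ.2).le
    gcongr
    exact hge δ hδ.1 hδ.2
  · filter_upwards [hsmall] with δ hδ
    have h0' : (0 : ℝ) < δ := hδ.1
    rw [← hk _ δ hC hδ.1 hδ.2]
    have := (hlog δ hδ.1 hδ.2).le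
    have hpos : 0 < N δ := lt_of_lt_of_le (by positivity) (hge δ hδ.1 hδ.2)
    gcongr
    exact (hle δ hδ.1 (hδ.2.trans (by rw [div_le_one] <;> norm_num))).2

end CoverBounds

/-! ### Dimensions of graph-directed attractors under the open set condition -/

namespace GraphDirectedIFS

open MeasureTheory Metric
open scoped ENNReal NNReal Classical

variable {V E X : Type*} [Fintype E]

/-- The total weight of the cells of level `n` at `v` that meet `U`, where the cell of a path with
end point `w` has weight `h w / l ^ n`. -/
def hitWeight (G : GraphDirectedIFS V E X) (K : V → Set X) (h : V → ℝ) (l : ℝ) :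
    ℕ → V → Set X → ℝ
  | 0, v, U => if (K v ∩ U).Nonempty then h v else 0
  | n + 1, v, U =>
    ∑ e with G.src e = v, l⁻¹ * hitWeight G K h l n (G.tgt e) (G.map e ⁻¹' U)

variable {G : GraphDirectedIFS V E X} {K : V → Set X} {h : V → ℝ} {l : ℝ}

theorem hitWeight_nonneg (hh : ∀ v, 0 < h v) (hl : 0 < l) (n : ℕ) (v : V) (U : Set X) :
    0 ≤ G.hitWeight K h l n v U := by
  induction n generalizing v U with
  | zero =>
    rw [hitWeight]
    split_ifs
    exacts [(hh v).le, le_rfl]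
  | succ n ih =>
    exact Finset.sum_nonneg fun e _ => mul_nonneg (inv_nonneg.2 hl.le) (ih _ _)

theorem hitWeight_mono (hh : ∀ v, 0 < h v) (hl : 0 < l) (n : ℕ) (v : V) {U U' : Set X}
    (hU : U ⊆ U') : G.hitWeight K h l n v U ≤ G.hitWeight K h l n v U' := by
  induction n generalizing v U U' with
  | zero =>
    simp only [hitWeight]
    split_ifs with h1 h2
    exacts [le_rfl, (h2 (h1.mono (inter_subset_inter_right _ hU))).elim, (hh v).le, le_rfl]
  | succ n ih =>
    exact Finset.sum_le_sum fun e _ =>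
      mul_le_mul_of_nonneg_left (ih _ (preimage_mono hU)) (inv_nonneg.2 hl.le)

theorem hitWeight_biUnion_le (hh : ∀ v, 0 < h v) (hl : 0 < l) {ι : Type*} (F : Finset ι)
    (n : ℕ) (v : V) (U : ι → Set X) :
    G.hitWeight K h l n v (⋃ i ∈ F, U i) ≤ ∑ i ∈ F, G.hitWeight K h l n v (U i) := by
  induction n generalizing v U with
  | zero =>
    rw [hitWeight]
    split_ifs with h1
    · obtain ⟨x, hxK, hx⟩ := h1
      obtain ⟨i, hi, hxi⟩ := mem_iUnion₂.1 hx
      have h2 : G.hitWeight K h l 0 v (U i) = h v := if_pos ⟨x, hxK, hxi⟩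
      rw [← h2]
      exact Finset.single_le_sum (f := fun i => G.hitWeight K h l 0 v (U i))
        (fun i _ => hitWeight_nonneg hh hl 0 v (U i)) hi
    · exact Finset.sum_nonneg fun i _ => hitWeight_nonneg hh hl 0 v (U i)
  | succ n ih =>
    simp only [hitWeight]
    rw [Finset.sum_comm]
    refine Finset.sum_le_sum fun e _ => ?_
    rw [← Finset.mul_sum, preimage_iUnion₂]
    exact mul_le_mul_of_nonneg_left (ih _ _) (inv_nonneg.2 hl.le)

/-- By the eigenvector equation the children of a cell carry exactly its weight; refining can only
discard children that miss `U`. -/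
theorem hitWeight_antitone (hh : ∀ v, 0 < h v) (hl : 0 < l)
    (heig : ∀ v, ∑ e with G.src e = v, h (G.tgt e) = l * h v)
    (hK : ∀ e, G.map e '' K (G.tgt e) ⊆ K (G.src e)) (v : V) (U : Set X) :
    Antitone fun n => G.hitWeight K h l n v U := by
  refine antitone_nat_of_succ_le fun n => ?_
  induction n generalizing v U with
  | zero =>
    by_cases hU : (K v ∩ U).Nonempty
    · have h1 : G.hitWeight K h l 0 v U = h v := if_pos hU
      rw [h1, hitWeight, ← Finset.mul_sum, inv_mul_le_iff₀ hl, ← heig v]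
      refine Finset.sum_le_sum fun e _ => ?_
      rw [hitWeight]
      split_ifs
      exacts [le_rfl, (hh _).le]
    · have h1 : G.hitWeight K h l 0 v U = 0 := if_neg hU
      rw [h1, hitWeight]
      refine Finset.sum_nonpos fun e he => ?_
      rw [hitWeight, if_neg, mul_zero]
      rintro ⟨x, hx, hxU⟩
      refine hU ⟨G.map e x, ?_, hxU⟩
      rw [← (Finset.mem_filter.1 he).2]
      exact hK e (mem_image_of_mem _ hx)
  | succ n ih =>
    rw [hitWeight, hitWeight]
    exact Finset.sum_le_sum fun e _ =>
      mul_le_mul_of_nonneg_left (ih _ _) (inv_nonneg.2 hl.le)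

/-- Every cell meets `K v`, so no weight is lost under subdivision. -/
theorem le_hitWeight_self (hh : ∀ v, 0 < h v) (hl : 0 < l)
    (heig : ∀ v, ∑ e with G.src e = v, h (G.tgt e) = l * h v)
    (hK : ∀ e, G.map e '' K (G.tgt e) ⊆ K (G.src e)) (hne : ∀ v, (K v).Nonempty) (n : ℕ) (v : V) :
    h v ≤ G.hitWeight K h l n v (K v) := by
  induction n generalizing v with
  | zero => rw [hitWeight, inter_self, if_pos (hne v)]
  | succ n ih =>
    rw [hitWeight, ← Finset.mul_sum, le_inv_mul_iff₀ hl, ← heig v]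
    refine Finset.sum_le_sum fun e he => (ih _).trans (hitWeight_mono hh hl n _ ?_)
    rw [← (Finset.mem_filter.1 he).2]
    exact image_subset_iff.1 (hK e)

/-- The number of cells of level `n` near `U` is bounded by comparing volumes. -/
theorem hitWeight_mul_le_measure [MetricSpace X] [CompleteSpace X] [SecondCountableTopology X]
    [MeasurableSpace X] [BorelSpace X] (μ : Measure X) {r : ℝ} (hr : G.IsSimilarWithRatio r)
    (hl : 0 < l) {O : V → Set X} (hO : ∀ v, IsOpen (O v)) (hfin : ∀ v, μ (O v) ≠ ∞)
    (hsub : ∀ e, G.map e '' O (G.tgt e) ⊆ O (G.src e))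
    (hdisj : ∀ e e', G.src e = G.src e' → e ≠ e' →
      Disjoint (G.map e '' O (G.tgt e)) (G.map e' '' O (G.tgt e')))
    {q : ℝ} (hq : 0 ≤ q) (hμ : ∀ e A, A ⊆ O (G.tgt e) → μ.real A ≤ q * μ.real (G.map e '' A))
    {D : ℝ} (hD : ∀ v, ∀ x ∈ K v, ∀ y ∈ O v, dist y x < D)
    {κ M : ℝ} (hκ : ∀ v, κ ≤ μ.real (O v)) (hκ0 : 0 ≤ κ) (hM : ∀ v, h v ≤ M) (hM0 : 0 ≤ M)
    (n : ℕ) (v : V) (U : Set X) :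
    G.hitWeight K h l n v U * κ
      ≤ M * (l⁻¹ * q) ^ n * μ.real (O v ∩ thickening (D * r ^ n) U) := by
  induction n generalizing v U with
  | zero =>
    rw [hitWeight]
    split_ifs with hU
    · obtain ⟨x, hx, hxU⟩ := hU
      have h1 : O v ∩ thickening (D * r ^ 0) U = O v := by
        refine inter_eq_left.2 fun y hy => mem_thickening_iff.2 ⟨x, hxU, ?_⟩
        simpa using hD v x hx y hy
      rw [h1, pow_zero, mul_one]
      exact mul_le_mul (hM v) (hκ v) hκ0 hM0
    · rw [zero_mul]
      positivity
  | succ n ih =>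
    -- The estimate is applied one level down to the preimage of `U`. The images of the sets `B e`
    -- are disjoint, and the contraction turns the radius `D * r ^ n` into `D * r ^ (n + 1)`.
    set B : E → Set X := fun e => O (G.tgt e) ∩ thickening (D * r ^ n) (G.map e ⁻¹' U) with hB
    have hBU : ∀ e, G.src e = v →
        G.map e '' B e ⊆ O v ∩ thickening (D * r ^ (n + 1)) U := by
      rintro e rfl _ ⟨x, ⟨hxO, hx⟩, rfl⟩
      obtain ⟨y, hy, hxy⟩ := mem_thickening_iff.1 hx
      refine ⟨hsub e (mem_image_of_mem _ hxO), mem_thickening_iff.2 ⟨G.map e y, hy, ?_⟩⟩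
      rw [hr.2.2, pow_succ, ← mul_assoc, mul_comm]
      exact mul_lt_mul_of_pos_right hxy hr.1
    have hmeas : ∀ e, MeasurableSet (G.map e '' B e) := fun e =>
      ((hO _).inter isOpen_thickening).measurableSet.image_of_continuousOn_injOn
        (hr.lipschitzWith e).continuous.continuousOn (hr.injective e).injOn
    have hfin' : μ (O v ∩ thickening (D * r ^ (n + 1)) U) ≠ ∞ :=
      measure_ne_top_of_subset inter_subset_left (hfin v)
    have hsum : ∑ e with G.src e = v, μ.real (G.map e '' B e)
        ≤ μ.real (O v ∩ thickening (D * r ^ (n + 1)) U) := by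
      have hfinB : ∀ e ∈ Finset.univ.filter fun e => G.src e = v, μ (G.map e '' B e) ≠ ∞ :=
        fun e he => measure_ne_top_of_subset (hBU e (Finset.mem_filter.1 he).2) hfin'
      rw [← measureReal_biUnion_finset _ (fun e _ => hmeas e) hfinB]
      · exact measureReal_mono (iUnion₂_subset fun e he => hBU e (Finset.mem_filter.1 he).2) hfin'
      · intro e he e' he' hne
        refine (hdisj e e' ?_ hne).mono (image_mono inter_subset_left)
          (image_mono inter_subset_left)
        rw [(Finset.mem_filter.1 he).2, (Finset.mem_filter.1 he').2]
    rw [hitWeight, Finset.sum_mul]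
    calc ∑ e with G.src e = v, l⁻¹ * G.hitWeight K h l n (G.tgt e) (G.map e ⁻¹' U) * κ
        ≤ ∑ e with G.src e = v, M * (l⁻¹ * q) ^ (n + 1) * μ.real (G.map e '' B e) := by
          refine Finset.sum_le_sum fun e _ => ?_
          rw [mul_assoc]
          calc l⁻¹ * (G.hitWeight K h l n (G.tgt e) (G.map e ⁻¹' U) * κ)
              ≤ l⁻¹ * (M * (l⁻¹ * q) ^ n * (q * μ.real (G.map e '' B e))) := by
                refine mul_le_mul_of_nonneg_left ?_ (inv_nonneg.2 hl.le)
                exact (ih _ _).trans (mul_le_mul_of_nonneg_left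
                  (hμ e _ inter_subset_left) (by positivity))
            _ = _ := by ring
      _ = M * (l⁻¹ * q) ^ (n + 1) * ∑ e with G.src e = v, μ.real (G.map e '' B e) := by
          rw [Finset.mul_sum]
      _ ≤ _ := by gcongr

/-- This identifies the weight `l ^ (-n)` of a cell with the `s`-th power of its scale `r ^ n`. -/
theorem rpow_similarityDimension {r : ℝ} (hr0 : 0 < r) (hr1 : r < 1) (hl : 0 < l) :
    r ^ (Real.log l / -Real.log r) = l⁻¹ := by
  have h0 : Real.log r ≠ 0 := (Real.log_neg hr0 hr1).ne
  rw [Real.rpow_def_of_pos hr0, div_neg, mul_neg, mul_div_cancel₀ _ h0, Real.exp_neg,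
    Real.exp_log hl]

theorem exists_finiteCoverLowerBound [Finite V] [NormedAddCommGroup X] [NormedSpace ℝ X]
    [FiniteDimensional ℝ X] {r : ℝ} (hr : G.IsSimilarWithRatio r) (hK : G.IsInvariantFamily K)
    (hG : G.OpenSetCondition) (hh : ∀ v, 0 < h v) (hl : 1 ≤ l)
    (heig : ∀ v, ∑ e with G.src e = v, h (G.tgt e) = l * h v) (v : V) :
    ∃ c, 0 < c ∧ FiniteCoverLowerBound (K v) (Real.log l / -Real.log r) c := by
  borelize X
  have : Nonempty V := ⟨v⟩
  obtain ⟨O, hO, hsub, hdisj⟩ := hG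
  have hl0 : 0 < l := one_pos.trans_le hl
  have hr0 := hr.1
  set d := Module.finrank ℝ X with hd
  -- In dimension `d` Hausdorff measure is both a Haar measure, which gives ball volumes, and
  -- controlled by distances, which gives the scaling bound `hμ` without affinity of the maps.
  set μ : Measure X := μH[d] with hμdef
  have hfin : ∀ v, μ (O v) ≠ ∞ := fun v => (hO v).2.2.measure_lt_top.ne
  obtain ⟨v₀, hv₀⟩ := Finite.exists_min fun v => μ.real (O v)
  have hκ : 0 < μ.real (O v₀) :=
    ENNReal.toReal_pos ((hO v₀).1.measure_pos μ (hO v₀).2.1).ne' (hfin v₀)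
  obtain ⟨v₁, hv₁⟩ := Finite.exists_max h
  have hb : Bornology.IsBounded (⋃ v, K v ∪ O v) :=
    Bornology.isBounded_iUnion.2 fun v => (hK.1 v).2.isBounded.union (hO v).2.2
  obtain ⟨D, hD0, hD⟩ : ∃ D, 0 < D ∧ ∀ v, ∀ x ∈ K v, ∀ y ∈ O v, dist y x < D := by
    obtain ⟨C, hC⟩ := isBounded_iff.1 hb
    refine ⟨max C 0 + 1, by positivity, fun v x hx y hy => ?_⟩
    have := hC (mem_iUnion.2 ⟨v, Or.inr hy⟩) (mem_iUnion.2 ⟨v, Or.inl hx⟩)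
    linarith [le_max_left C 0]
  have hμ : ∀ e A, A ⊆ O (G.tgt e) → μ.real A ≤ (r⁻¹) ^ d * μ.real (G.map e '' A) := by
    intro e A hA
    have h1 := (hr.antilipschitzWith e).le_hausdorffMeasure_image (Nat.cast_nonneg d) A
    have h2 : μ (G.map e '' A) ≠ ∞ :=
      measure_ne_top_of_subset ((image_mono hA).trans (hsub e)) (hfin _)
    rw [ENNReal.rpow_natCast] at h1
    have h3 := ENNReal.toReal_mono
      (ENNReal.mul_ne_top (ENNReal.pow_ne_top ENNReal.coe_ne_top) h2) h1
    rw [ENNReal.toReal_mul, ENNReal.toReal_pow, ENNReal.coe_toReal,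
      Real.coe_toNNReal _ (inv_nonneg.2 hr0.le)] at h3
    exact h3
  set s := Real.log l / -Real.log r with hs
  have hrs : r ^ s = l⁻¹ := rpow_similarityDimension hr0 hr.2.1 hl0
  have hs0 : 0 ≤ s := div_nonneg (Real.log_nonneg hl) (neg_nonneg.2 (Real.log_neg hr0 hr.2.1).le)
  have hrn : ∀ n : ℕ, (r ^ n) ^ s = (l⁻¹) ^ n := by
    intro n
    rw [← hrs, ← Real.rpow_natCast, ← Real.rpow_natCast, ← Real.rpow_mul hr0.le,
      ← Real.rpow_mul hr0.le, mul_comm]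
  set b := μ.real (ball (0 : X) 1) with hbdef
  have hb0 : 0 < b := ENNReal.toReal_pos (measure_ball_pos μ 0 one_pos).ne' measure_ball_lt_top.ne
  set C := h v₁ * ((D + 1) ^ d * b) / μ.real (O v₀) with hC
  have hC0 : 0 < C := div_pos (mul_pos (hh _) (by positivity)) hκ
  -- The `D * r ^ n`-neighbourhood of `U` lies in a ball of radius `(D + 1) * r ^ n`; in the volume
  -- bound the powers of `r` cancel.
  have hcell : ∀ (n : ℕ) (U : Set X), (∀ x ∈ U, ∀ y ∈ U, dist x y ≤ r ^ n) →
      G.hitWeight K h l n v U ≤ C * (l⁻¹) ^ n := by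
    intro n U hU
    have key := hitWeight_mul_le_measure μ hr hl0 (fun v => (hO v).1) hfin hsub hdisj
      (by positivity) hμ hD hv₀ hκ.le hv₁ (hh v₁).le n v U
    have hvol : μ.real (O v ∩ thickening (D * r ^ n) U) ≤ ((D + 1) * r ^ n) ^ d * b := by
      rcases U.eq_empty_or_nonempty with rfl | ⟨x, hx⟩
      · simp only [thickening_empty, inter_empty, measureReal_empty]
        positivity
      · rw [hbdef, ← Measure.addHaar_real_closedBall μ x (by positivity)]
        refine measureReal_mono (fun y hy => ?_) measure_closedBall_lt_top.ne
        obtain ⟨z, hz, hyz⟩ := mem_thickening_iff.1 hy.2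
        rw [mem_closedBall]
        have := dist_triangle y z x
        have := hU z hz x hx
        linarith
    rw [hC, div_mul_eq_mul_div, le_div_iff₀ hκ]
    refine (key.trans (mul_le_mul_of_nonneg_left hvol
      (mul_nonneg (hh v₁).le (by positivity)))).trans_eq ?_
    have h1 : (l⁻¹ * r⁻¹ ^ d) ^ n * ((D + 1) * r ^ n) ^ d = (D + 1) ^ d * (l⁻¹) ^ n := by
      rw [mul_pow, mul_pow, ← pow_mul, ← pow_mul, mul_comm n d, inv_pow r]
      field_simp
    linear_combination h v₁ * b * h1
  -- The factor `l` pays for rounding a diameter up to a power of `r`. All covering sets are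
  -- compared at the deepest level `F.sup n`, then each is moved back to its own level by
  -- monotonicity.
  refine ⟨h v / (C * l), div_pos (hh v) (by positivity), fun F hF hcov => ?_⟩
  have hn : ∀ p : Set X × ℝ, ∃ n : ℕ, p ∈ F → r ^ (n + 1) < p.2 ∧ p.2 ≤ r ^ n := by
    intro p
    by_cases hp : p ∈ F
    · obtain ⟨n, h1, h2⟩ := exists_nat_pow_near_of_lt_one (hF p hp).1 (hF p hp).2.1 hr0 hr.2.1
      exact ⟨n, fun _ => ⟨h1, h2⟩⟩
    · exact ⟨0, fun h => (hp h).elim⟩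
  choose n hn using hn
  rw [div_le_iff₀ (by positivity), Finset.sum_mul]
  calc h v ≤ G.hitWeight K h l (F.sup n) v (K v) :=
        le_hitWeight_self hh hl0 heig hK.image_subset (fun v => (hK.1 v).1) _ v
    _ ≤ G.hitWeight K h l (F.sup n) v (⋃ p ∈ F, p.1) := hitWeight_mono hh hl0 _ v hcov
    _ ≤ ∑ p ∈ F, G.hitWeight K h l (F.sup n) v p.1 := hitWeight_biUnion_le hh hl0 F _ v _
    _ ≤ ∑ p ∈ F, p.2 ^ s * (C * l) := by
        refine Finset.sum_le_sum fun p hp => ?_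
        obtain ⟨h1, h2⟩ := hn p hp
        refine (hitWeight_antitone hh hl0 heig hK.image_subset v p.1 (Finset.le_sup hp)).trans ?_
        refine (hcell (n p) p.1 fun x hx y hy => ((hF p hp).2.2 x hx y hy).trans h2).trans ?_
        have h3 : (r ^ (n p + 1)) ^ s ≤ p.2 ^ s := Real.rpow_le_rpow (by positivity) h1.le hs0
        rw [hrn, pow_succ] at h3
        have h4 := mul_le_mul_of_nonneg_right h3 (mul_pos hC0 hl0).le
        refine le_trans (le_of_eq ?_) h4
        field_simp

/-- One ball per cell suffices. Each cell weighs at least `h v₀ / l ^ n` and the total is `h v`, so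
there are at most `h v * l ^ n / h v₀` cells; no separation is needed. -/
theorem exists_ballCoverUpperBound [Finite V] [MetricSpace X] {r : ℝ}
    (hr : G.IsSimilarWithRatio r) (hK : G.IsInvariantFamily K) (hh : ∀ v, 0 < h v) (hl : 1 ≤ l)
    (heig : ∀ v, ∑ e with G.src e = v, h (G.tgt e) = l * h v) (v : V) :
    ∃ C, BallCoverUpperBound (K v) (Real.log l / -Real.log r) C := by
  have : Nonempty V := ⟨v⟩
  have hl0 : 0 < l := one_pos.trans_le hl
  have hr0 := hr.1
  obtain ⟨v₀, hv₀⟩ := Finite.exists_min h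
  have hb : Bornology.IsBounded (⋃ v, K v) :=
    Bornology.isBounded_iUnion.2 fun v => (hK.1 v).2.isBounded
  -- `1 ≤ D` ensures `δ / D ≤ 1`, so that `δ / D` lies between consecutive powers of `r`.
  obtain ⟨D, hD1, hD⟩ : ∃ D : ℝ, 1 ≤ D ∧ ∀ v, ∀ x ∈ K v, ∀ y ∈ K v, dist x y ≤ D := by
    obtain ⟨C, hC⟩ := isBounded_iff.1 hb
    exact ⟨max C 1, le_max_right _ _, fun v x hx y hy =>
      (hC (mem_iUnion.2 ⟨v, hx⟩) (mem_iUnion.2 ⟨v, hy⟩)).trans (le_max_left _ _)⟩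
  have key : ∀ (n : ℕ) (v : V), ∃ t : Finset X, K v ⊆ ⋃ x ∈ t, closedBall x (D * r ^ n) ∧
      (t.card : ℝ) * h v₀ ≤ h v * l ^ n := by
    intro n
    induction n with
    | zero =>
      intro v
      obtain ⟨x, hx⟩ := (hK.1 v).1
      refine ⟨{x}, fun y hy => ?_, by simpa using hv₀ v⟩
      simpa using hD v y hy x hx
    | succ n ih =>
      intro v
      choose t ht hcard using ih
      refine ⟨(Finset.univ.filter fun e => G.src e = v).biUnion fun e =>
        (t (G.tgt e)).image (G.map e), fun x hx => ?_, ?_⟩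
      · obtain ⟨e, he, y, hy, rfl⟩ := hK.exists_edge hx
        obtain ⟨z, hz, hyz⟩ := mem_iUnion₂.1 (ht _ hy)
        refine mem_iUnion₂.2 ⟨G.map e z, Finset.mem_biUnion.2
          ⟨e, by simpa using he, Finset.mem_image_of_mem _ hz⟩, ?_⟩
        rw [mem_closedBall] at hyz ⊢
        rw [hr.2.2, pow_succ]
        nlinarith [mul_le_mul_of_nonneg_left hyz hr0.le]
      · have h1 : (((Finset.univ.filter fun e => G.src e = v).biUnion fun e =>
            (t (G.tgt e)).image (G.map e)).card : ℝ)
            ≤ ∑ e with G.src e = v, ((t (G.tgt e)).card : ℝ) := by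
          exact_mod_cast Finset.card_biUnion_le.trans
            (Finset.sum_le_sum fun e _ => Finset.card_image_le)
        calc _ ≤ (∑ e with G.src e = v, ((t (G.tgt e)).card : ℝ)) * h v₀ :=
              mul_le_mul_of_nonneg_right h1 (hh v₀).le
          _ ≤ ∑ e with G.src e = v, h (G.tgt e) * l ^ n := by
              rw [Finset.sum_mul]
              exact Finset.sum_le_sum fun e _ => hcard _
          _ = h v * l ^ (n + 1) := by
              rw [← Finset.sum_mul, heig]
              ring
  set s := Real.log l / -Real.log r with hs
  have hrs : r ^ s = l⁻¹ := rpow_similarityDimension hr0 hr.2.1 hl0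
  have hs0 : 0 ≤ s := div_nonneg (Real.log_nonneg hl) (neg_nonneg.2 (Real.log_neg hr0 hr.2.1).le)
  have hD0 : 0 < D := one_pos.trans_le hD1
  refine ⟨h v * l * D ^ s / h v₀, fun δ h0 h1 => ?_⟩
  obtain ⟨n, hn1, hn2⟩ := exists_nat_pow_near_of_lt_one (div_pos h0 hD0)
    ((div_le_one hD0).2 (h1.trans hD1)) hr0 hr.2.1
  obtain ⟨t, ht, hcard⟩ := key (n + 1) v
  have hrad : D * r ^ (n + 1) ≤ δ := by
    rw [lt_div_iff₀ hD0] at hn1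
    linarith
  refine ⟨t, ht.trans (iUnion₂_mono fun x _ => closedBall_subset_closedBall hrad), ?_⟩
  have hln : l ^ n ≤ D ^ s * δ ^ (-s) := by
    have h2 := Real.rpow_le_rpow (div_pos h0 hD0).le hn2 hs0
    have h3 : (r ^ n) ^ s = (l ^ n)⁻¹ := by
      rw [← inv_pow, ← hrs, ← Real.rpow_natCast, ← Real.rpow_natCast, ← Real.rpow_mul hr0.le,
        ← Real.rpow_mul hr0.le, mul_comm]
    rw [h3, le_inv_comm₀ (by positivity) (by positivity), Real.div_rpow h0.le hD0.le, inv_div,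
      div_eq_mul_inv, ← Real.rpow_neg h0.le] at h2
    exact h2
  rw [div_mul_eq_mul_div, le_div_iff₀ (hh v₀)]
  refine hcard.trans ?_
  have := mul_le_mul_of_nonneg_left hln (mul_pos (hh v) hl0).le
  rw [pow_succ]
  linarith

theorem dimension_eq_of_openSetCondition [Finite V] [NormedAddCommGroup X] [NormedSpace ℝ X]
    [FiniteDimensional ℝ X] {r : ℝ} (hr : G.IsSimilarWithRatio r) (hK : G.IsInvariantFamily K)
    (hG : G.OpenSetCondition) (hh : ∀ v, 0 < h v) (hl : 1 ≤ l)
    (heig : ∀ v, ∑ e with G.src e = v, h (G.tgt e) = l * h v) (v : V) :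
    dimH (K v) = ENNReal.ofReal (Real.log l / -Real.log r) ∧
      HasBoxDim (K v) (Real.log l / -Real.log r) := by
  obtain ⟨c, hc, hlow⟩ := exists_finiteCoverLowerBound hr hK hG hh hl heig v
  obtain ⟨C, hup⟩ := exists_ballCoverUpperBound hr hK hh hl heig v
  have hs0 : 0 ≤ Real.log l / -Real.log r :=
    div_nonneg (Real.log_nonneg hl) (neg_nonneg.2 (Real.log_neg hr.1 hr.2.1).le)
  exact ⟨(hup.dimH_le hs0).antisymm (hlow.le_dimH (hK.1 v).2 hc),
    hasBoxDim_of_cover_bounds (hK.1 v).2.totallyBounded (hK.1 v).1 hc hlow hup⟩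

end GraphDirectedIFS

/-! ### The maps of a triangular patterns system -/

namespace TriangularLabyrinth

variable (P : AffineBasis (Fin 3) ℝ Plane)

/-- Affinity lets `proj` pass through affine combinations and convex hulls. -/
theorem exists_affineMap_eq_proj (A : Triangle) : ∃ f : Plane →ᵃ[ℝ] Plane, ⇑f = proj P A := by
  refine ⟨∑ i, (LinearMap.toSpanSingleton ℝ Plane (A i)).toAffineMap.comp (P.coord i), ?_⟩
  funext x
  simp [proj, Fin.sum_univ_three]

theorem proj_vertex (A : Triangle) (i : Fin 3) : proj P A (P i) = A i := by
  simp [proj, AffineBasis.coord_apply]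

theorem affineMap_sum_smul (f : Plane →ᵃ[ℝ] Plane) (w : Fin 3 → ℝ) (hw : ∑ i, w i = 1)
    (B : Triangle) : f (∑ i, w i • B i) = ∑ i, w i • f (B i) := by
  rw [← Finset.affineCombination_eq_linear_combination _ _ _ hw,
    Finset.map_affineCombination _ _ _ hw, Finset.affineCombination_eq_linear_combination _ _ _ hw]
  rfl

theorem proj_sub (A B : Triangle) (x : Plane) : proj P (sub P A B) x = proj P A (proj P B x) := by
  obtain ⟨f, hf⟩ := exists_affineMap_eq_proj P A
  rw [← hf, proj, proj, affineMap_sum_smul f _ (P.sum_coord_apply_eq_one x), hf]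
  rfl

theorem sub_assoc (A B C : Triangle) : sub P (sub P A B) C = sub P A (sub P B C) :=
  funext fun _ => proj_sub P A B _

theorem full_eq_image (A : Triangle) : A.full = proj P A '' convexHull ℝ (range P) := by
  obtain ⟨f, hf⟩ := exists_affineMap_eq_proj P A
  rw [← hf, f.image_convexHull, ← range_comp, hf, Triangle.full]
  congr 2
  funext i
  exact (proj_vertex P A i).symm

theorem full_sub (A B : Triangle) : (sub P A B).full = proj P A '' B.full := by
  rw [full_eq_image P, full_eq_image P B, image_image]
  exact image_congr fun x _ => proj_sub P A B x

theorem coord_sum_smul (w : Fin 3 → ℝ) (hw : ∑ i, w i = 1) (j : Fin 3) :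
    P.coord j (∑ i, w i • P i) = w j := by
  rw [← Finset.affineCombination_eq_linear_combination _ _ _ hw]
  exact P.coord_apply_combination_of_mem (Finset.mem_univ j) hw

variable {P} {m : ℕ}

theorem proj_upright (k : Fin 3 → ℕ) (x : Plane) :
    proj P (upright P m k) x = (m : ℝ)⁻¹ • (∑ j, (k j : ℝ) • P j + x) := by
  have h1 := P.sum_coord_apply_eq_one x
  have h2 := P.linear_combination_coord_eq_self x
  rw [Fin.sum_univ_three] at h1 h2
  conv_rhs => rw [← h2]
  simp only [proj, upright, Fin.sum_univ_three]
  simp only [Fin.isValue, Fin.reduceEq, if_true, if_false, add_zero]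
  linear_combination (norm := module) (m : ℝ)⁻¹ • h1 • ((k 0 : ℝ) • P 0 + (k 1 : ℝ) • P 1 + (k 2 : ℝ) • P 2)

theorem proj_upsideDown (k : Fin 3 → ℕ) (x : Plane) :
    proj P (upsideDown P m k) x
      = (m : ℝ)⁻¹ • (∑ j, ((k j : ℝ) + 1) • P j - x) := by
  have h1 := P.sum_coord_apply_eq_one x
  have h2 := P.linear_combination_coord_eq_self x
  rw [Fin.sum_univ_three] at h1 h2
  conv_rhs => rw [← h2]
  simp only [proj, upsideDown, Fin.sum_univ_three]
  simp only [Fin.isValue, Fin.reduceEq, if_true, if_false, add_zero]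
  linear_combination (norm := module) (m : ℝ)⁻¹ • h1 • (((k 0 : ℝ) + 1) • P 0 + ((k 1 : ℝ) + 1) • P 1
    + ((k 2 : ℝ) + 1) • P 2)

theorem coord_proj_upright {k : Fin 3 → ℕ} (hk : ∑ i, k i + 1 = m) (x : Plane) (j : Fin 3) :
    P.coord j (proj P (upright P m k) x) = (m : ℝ)⁻¹ * (k j + P.coord j x) := by
  have hm : (m : ℝ) ≠ 0 := by
    rw [← hk]
    positivity
  have h1 : proj P (upright P m k) x
      = ∑ j, ((m : ℝ)⁻¹ * (k j + P.coord j x)) • P j := by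
    rw [proj_upright]
    conv_lhs => rw [← P.linear_combination_coord_eq_self x]
    simp only [← Finset.sum_add_distrib, Finset.smul_sum, ← add_smul, smul_smul]
  rw [h1, coord_sum_smul]
  rw [← Finset.mul_sum, Finset.sum_add_distrib, P.sum_coord_apply_eq_one, inv_mul_eq_one₀ hm, ← hk]
  push_cast
  rfl

theorem coord_proj_upsideDown {k : Fin 3 → ℕ} (hk : ∑ i, k i + 2 = m) (x : Plane) (j : Fin 3) :
    P.coord j (proj P (upsideDown P m k) x) = (m : ℝ)⁻¹ * (k j + 1 - P.coord j x) := by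
  have hm : (m : ℝ) ≠ 0 := by
    rw [← hk]
    positivity
  have h1 : proj P (upsideDown P m k) x
      = ∑ j, ((m : ℝ)⁻¹ * (k j + 1 - P.coord j x)) • P j := by
    rw [proj_upsideDown]
    conv_lhs => rw [← P.linear_combination_coord_eq_self x]
    simp only [← Finset.sum_sub_distrib, Finset.smul_sum, ← sub_smul, smul_smul]
  rw [h1, coord_sum_smul]
  rw [← Finset.mul_sum, Finset.sum_sub_distrib, P.sum_coord_apply_eq_one, inv_mul_eq_one₀ hm, ← hk,
    Finset.sum_add_distrib]
  push_cast
  simp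
  ring

theorem dist_proj_upright (k : Fin 3 → ℕ) (x y : Plane) :
    dist (proj P (upright P m k) x) (proj P (upright P m k) y) = 1 / (m : ℝ) * dist x y := by
  rw [proj_upright, proj_upright, dist_smul₀, dist_add_left, Real.norm_of_nonneg (by positivity),
    one_div]

theorem dist_proj_upsideDown (k : Fin 3 → ℕ) (x y : Plane) :
    dist (proj P (upsideDown P m k) x) (proj P (upsideDown P m k) y)
      = 1 / (m : ℝ) * dist x y := by
  rw [proj_upsideDown, proj_upsideDown, dist_smul₀, dist_sub_left,
    Real.norm_of_nonneg (by positivity), one_div]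

/-! ### The open triangle -/

variable (P) in
/-- The interior of the triangle spanned by the basis points. -/
def openTriangle : Set Plane := {x | ∀ i, 0 < P.coord i x}

theorem openTriangle_eq_interior : openTriangle P = interior (convexHull ℝ (range P)) :=
  P.interior_convexHull.symm

theorem isOpen_openTriangle : IsOpen (openTriangle P) := by
  rw [openTriangle_eq_interior]
  exact isOpen_interior

theorem openTriangle_nonempty : (openTriangle P).Nonempty := by
  refine ⟨∑ i, (1 / 3 : ℝ) • P i, fun j => ?_⟩
  rw [coord_sum_smul P (fun _ => 1 / 3) (by simp)]
  norm_num

theorem isCompact_triangle : IsCompact (convexHull ℝ (range P)) :=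
  (finite_range P).isCompact_convexHull (𝕜 := ℝ)

theorem isBounded_openTriangle : Bornology.IsBounded (openTriangle P) := by
  rw [openTriangle_eq_interior]
  exact isCompact_triangle.isBounded.subset interior_subset

theorem coord_lt_one {x : Plane} (hx : x ∈ openTriangle P) (j : Fin 3) : P.coord j x < 1 := by
  have h1 := P.sum_coord_apply_eq_one x
  rw [Fin.sum_univ_three] at h1
  have h2 := hx 0
  have h3 := hx 1
  have h4 := hx 2
  fin_cases j <;> simp only [Fin.zero_eta, Fin.mk_one, Fin.reduceFinMk] <;> linarith

theorem coord_le_one {x : Plane} (hx : x ∈ convexHull ℝ (range P)) (j : Fin 3) :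
    P.coord j x ≤ 1 := by
  rw [P.convexHull_eq_nonneg_coord] at hx
  rw [← P.sum_coord_apply_eq_one x]
  exact Finset.single_le_sum (f := fun j => P.coord j x) (fun i _ => hx i) (Finset.mem_univ j)

/-- Uniqueness of integer parts, which separates the small open triangles. -/
theorem natCast_eq_of_add_eq {a b : ℕ} {s t : ℝ} (hs : 0 < s) (hs1 : s < 1) (ht : 0 < t)
    (ht1 : t < 1) (h : (a : ℝ) + s = b + t) : a = b := by
  have h1 : (a : ℝ) < b + 1 := by linarith
  have h2 : (b : ℝ) < a + 1 := by linarith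
  have h3 : a < b + 1 := by exact_mod_cast h1
  have h4 : b < a + 1 := by exact_mod_cast h2
  omega

theorem eq_of_proj_eq_of_upright (hm : m ≠ 0) {T T' : Triangle} (hT : T ∈ uprightTriangles P m)
    (hT' : T' ∈ uprightTriangles P m) {x y : Plane} (hx : x ∈ openTriangle P)
    (hy : y ∈ openTriangle P) (h : proj P T x = proj P T' y) : T = T' := by
  obtain ⟨k, hk, rfl⟩ := hT
  obtain ⟨k', hk', rfl⟩ := hT'
  congr 1
  funext j
  have h1 := congrArg (P.coord j) h
  rw [coord_proj_upright hk, coord_proj_upright hk'] at h1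
  have h2 := mul_left_cancel₀ (inv_ne_zero (Nat.cast_ne_zero.2 hm)) h1
  exact natCast_eq_of_add_eq (hx j) (coord_lt_one hx j) (hy j) (coord_lt_one hy j) h2

theorem eq_of_proj_eq_of_upsideDown (hm : m ≠ 0) {T T' : Triangle}
    (hT : T ∈ upsideDownTriangles P m) (hT' : T' ∈ upsideDownTriangles P m) {x y : Plane}
    (hx : x ∈ openTriangle P) (hy : y ∈ openTriangle P) (h : proj P T x = proj P T' y) :
    T = T' := by
  obtain ⟨k, hk, rfl⟩ := hT
  obtain ⟨k', hk', rfl⟩ := hT'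
  congr 1
  funext j
  have h1 := congrArg (P.coord j) h
  rw [coord_proj_upsideDown hk, coord_proj_upsideDown hk'] at h1
  have h2 := mul_left_cancel₀ (inv_ne_zero (Nat.cast_ne_zero.2 hm)) h1
  have := hx j
  have := hy j
  have := coord_lt_one hx j
  have := coord_lt_one hy j
  exact natCast_eq_of_add_eq (s := 1 - P.coord j x) (t := 1 - P.coord j y) (by linarith)
    (by linarith) (by linarith) (by linarith) (by linarith)

theorem proj_upright_ne_proj_upsideDown (hm : m ≠ 0) {T T' : Triangle}
    (hT : T ∈ uprightTriangles P m) (hT' : T' ∈ upsideDownTriangles P m) {x y : Plane}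
    (hx : x ∈ openTriangle P) (hy : y ∈ openTriangle P) : proj P T x ≠ proj P T' y := by
  intro h
  obtain ⟨k, hk, rfl⟩ := hT
  obtain ⟨k', hk', rfl⟩ := hT'
  have hkk : k = k' := by
    funext j
    have h1 := congrArg (P.coord j) h
    rw [coord_proj_upright hk, coord_proj_upsideDown hk'] at h1
    have h2 := mul_left_cancel₀ (inv_ne_zero (Nat.cast_ne_zero.2 hm)) h1
    have := hy j
    have := coord_lt_one hy j
    exact natCast_eq_of_add_eq (t := 1 - P.coord j y) (hx j) (coord_lt_one hx j) (by linarith)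
      (by linarith) (by linarith)
  subst hkk
  -- Equal `k` would have coordinate sum both `m - 1` and `m - 2`.
  omega

theorem mem_triangle {x : Plane} : x ∈ convexHull ℝ (range P) ↔ ∀ i, 0 ≤ P.coord i x := by
  rw [P.convexHull_eq_nonneg_coord]
  rfl

theorem image_proj_triangle_subset {T : Triangle}
    (hT : T ∈ uprightTriangles P m ∪ upsideDownTriangles P m) :
    proj P T '' convexHull ℝ (range P) ⊆ convexHull ℝ (range P) := by
  rintro _ ⟨x, hx, rfl⟩
  refine mem_triangle.2 fun j => ?_
  have h0 := mem_triangle.1 hx j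
  have h1 := coord_le_one hx j
  rcases hT with ⟨k, hk, rfl⟩ | ⟨k, hk, rfl⟩
  · rw [coord_proj_upright hk]
    positivity
  · rw [coord_proj_upsideDown hk]
    have : 0 ≤ (k j : ℝ) + 1 - P.coord j x := by linarith [(k j).cast_nonneg (α := ℝ)]
    positivity

theorem image_proj_openTriangle_subset (hm : m ≠ 0) {T : Triangle}
    (hT : T ∈ uprightTriangles P m ∪ upsideDownTriangles P m) :
    proj P T '' openTriangle P ⊆ openTriangle P := by
  rintro _ ⟨x, hx, rfl⟩ j
  have h0 := hx j
  have h1 := coord_lt_one hx j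
  have hm' : (0 : ℝ) < (m : ℝ)⁻¹ := inv_pos.2 (Nat.cast_pos.2 (Nat.pos_of_ne_zero hm))
  rcases hT with ⟨k, hk, rfl⟩ | ⟨k, hk, rfl⟩
  · rw [coord_proj_upright hk]
    positivity
  · rw [coord_proj_upsideDown hk]
    exact mul_pos hm' (by linarith [(k j).cast_nonneg (α := ℝ)])

theorem dist_proj {T : Triangle} (hT : T ∈ uprightTriangles P m ∪ upsideDownTriangles P m)
    (x y : Plane) : dist (proj P T x) (proj P T y) = 1 / (m : ℝ) * dist x y := by
  rcases hT with ⟨k, hk, rfl⟩ | ⟨k, hk, rfl⟩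
  exacts [dist_proj_upright k x y, dist_proj_upsideDown k x y]

end TriangularLabyrinth

/-! ### The graph-directed system of a triangular patterns system -/

namespace TriangularLabyrinth

namespace PatternsSystem

open scoped Classical

variable {P : AffineBasis (Fin 3) ℝ Plane} {m : ℕ}

instance : Finite Vertex :=
  Finite.of_injective (fun v : Vertex => match v with | .white => true | .yellow => false) <| by
    rintro (_ | _) (_ | _) <;> simp

/-- The edges are the elements of the four sets of triangles. -/
def edgeEquiv (S : PatternsSystem P m) : Edge S ≃ ((S.W ⊕ S.W') ⊕ (S.Y ⊕ S.Y')) where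
  toFun
    | .ofW T => .inl (.inl T)
    | .ofW' T => .inl (.inr T)
    | .ofY T => .inr (.inl T)
    | .ofY' T => .inr (.inr T)
  invFun
    | .inl (.inl T) => .ofW T
    | .inl (.inr T) => .ofW' T
    | .inr (.inl T) => .ofY T
    | .inr (.inr T) => .ofY' T
  left_inv := by rintro (_ | _ | _ | _) <;> rfl
  right_inv := by rintro ((_ | _) | (_ | _)) <;> rfl

instance (S : PatternsSystem P m) : Fintype (Edge S) := Fintype.ofEquiv _ S.edgeEquiv.symm

theorem sum_edge (S : PatternsSystem P m) (f : Edge S → ℝ) :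
    ∑ e, f e = ((∑ T, f (.ofW T)) + ∑ T, f (.ofW' T)) + ((∑ T, f (.ofY T)) + ∑ T, f (.ofY' T)) := by
  rw [← S.edgeEquiv.symm.sum_comp, Fintype.sum_sum_type, Fintype.sum_sum_type,
    Fintype.sum_sum_type]
  rfl

theorem sum_edge_white (S : PatternsSystem P m) (h : Vertex → ℝ) :
    ∑ e with S.gifs.src e = .white, h (S.gifs.tgt e)
      = S.W.card * h .white + S.W'.card * h .yellow := by
  rw [Finset.sum_filter, sum_edge]
  simp [gifs]

theorem sum_edge_yellow (S : PatternsSystem P m) (h : Vertex → ℝ) :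
    ∑ e with S.gifs.src e = .yellow, h (S.gifs.tgt e)
      = S.Y.card * h .yellow + S.Y'.card * h .white := by
  rw [Finset.sum_filter, sum_edge]
  simp [gifs]

theorem iUnion_edge_white (S : PatternsSystem P m) (K : Vertex → Set Plane) :
    ⋃ e ∈ {e | S.gifs.src e = .white}, S.gifs.map e '' K (S.gifs.tgt e)
      = (⋃ T ∈ S.W, proj P T '' K .white) ∪ ⋃ T ∈ S.W', proj P T '' K .yellow := by
  ext x
  simp only [mem_iUnion₂, mem_union]
  constructor
  · rintro ⟨(T | T | T | T), he, hx⟩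
    exacts [Or.inl ⟨T, T.2, hx⟩, Or.inr ⟨T, T.2, hx⟩, absurd he (by simp [gifs]),
      absurd he (by simp [gifs])]
  · rintro (⟨T, hT, hx⟩ | ⟨T, hT, hx⟩)
    exacts [⟨.ofW ⟨T, hT⟩, rfl, hx⟩, ⟨.ofW' ⟨T, hT⟩, rfl, hx⟩]

theorem iUnion_edge_yellow (S : PatternsSystem P m) (K : Vertex → Set Plane) :
    ⋃ e ∈ {e | S.gifs.src e = .yellow}, S.gifs.map e '' K (S.gifs.tgt e)
      = (⋃ T ∈ S.Y, proj P T '' K .yellow) ∪ ⋃ T ∈ S.Y', proj P T '' K .white := by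
  ext x
  simp only [mem_iUnion₂, mem_union]
  constructor
  · rintro ⟨(T | T | T | T), he, hx⟩
    exacts [absurd he (by simp [gifs]), absurd he (by simp [gifs]), Or.inl ⟨T, T.2, hx⟩,
      Or.inr ⟨T, T.2, hx⟩]
  · rintro (⟨T, hT, hx⟩ | ⟨T, hT, hx⟩)
    exacts [⟨.ofY ⟨T, hT⟩, rfl, hx⟩, ⟨.ofY' ⟨T, hT⟩, rfl, hx⟩]

theorem exists_map_eq_proj (S : PatternsSystem P m) (e : Edge S) :
    ∃ T ∈ uprightTriangles P m ∪ upsideDownTriangles P m, S.gifs.map e = proj P T := by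
  rcases e with T | T | T | T
  exacts [⟨T, Or.inl (S.hW T.2), rfl⟩, ⟨T, Or.inr (S.hW' T.2), rfl⟩, ⟨T, Or.inl (S.hY T.2), rfl⟩,
    ⟨T, Or.inr (S.hY' T.2), rfl⟩]

theorem isSimilarWithRatio (S : PatternsSystem P m) (hm : 2 ≤ m) :
    S.gifs.IsSimilarWithRatio (1 / (m : ℝ)) := by
  have hm' : (1 : ℝ) < m := by exact_mod_cast hm
  refine ⟨by positivity, (div_lt_one (by positivity)).2 hm', fun e x y => ?_⟩
  obtain ⟨T, hT, he⟩ := S.exists_map_eq_proj e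
  rw [he, dist_proj hT]

theorem openSetCondition (S : PatternsSystem P m) (hm : m ≠ 0) : S.gifs.OpenSetCondition := by
  refine ⟨fun _ => openTriangle P, fun _ => ⟨isOpen_openTriangle, openTriangle_nonempty,
    isBounded_openTriangle⟩, fun e => ?_, fun e e' hee hne => ?_⟩
  · obtain ⟨T, hT, he⟩ := S.exists_map_eq_proj e
    rw [he]
    exact image_proj_openTriangle_subset hm hT
  · rw [Set.disjoint_left]
    rintro _ ⟨x, hx, rfl⟩ ⟨y, hy, hyx⟩
    -- Same-type edges would carry the same triangle, an upright and an upside down image never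
    -- meet, and pairs with different sources are excluded by `hee`.
    rcases e with T | T | T | T <;> rcases e' with T' | T' | T' | T' <;>
      first
      | exact hne (congrArg _ (Subtype.ext
          (eq_of_proj_eq_of_upright hm (S.hW T.2) (S.hW T'.2) hx hy hyx.symm)))
      | exact hne (congrArg _ (Subtype.ext
          (eq_of_proj_eq_of_upsideDown hm (S.hW' T.2) (S.hW' T'.2) hx hy hyx.symm)))
      | exact hne (congrArg _ (Subtype.ext
          (eq_of_proj_eq_of_upright hm (S.hY T.2) (S.hY T'.2) hx hy hyx.symm)))
      | exact hne (congrArg _ (Subtype.ext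
          (eq_of_proj_eq_of_upsideDown hm (S.hY' T.2) (S.hY' T'.2) hx hy hyx.symm)))
      | exact proj_upright_ne_proj_upsideDown hm (S.hW T.2) (S.hW' T'.2) hx hy hyx.symm
      | exact proj_upright_ne_proj_upsideDown hm (S.hW T'.2) (S.hW' T.2) hy hx hyx
      | exact proj_upright_ne_proj_upsideDown hm (S.hY T.2) (S.hY' T'.2) hx hy hyx.symm
      | exact proj_upright_ne_proj_upsideDown hm (S.hY T'.2) (S.hY' T.2) hy hx hyx
      | exact absurd hee (by simp [gifs])

/-- The triangles of the next level, decomposed by their first instead of their last letter. -/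
theorem whiteLevel_succ_eq (n : ℕ) (S : PatternsSystem P m) :
    S.whiteLevel (n + 1) =
      (image2 (sub P) ↑S.W (S.whiteLevel n).1 ∪ image2 (sub P) ↑S.W' (S.swap.whiteLevel n).2,
        image2 (sub P) ↑S.W (S.whiteLevel n).2 ∪
          image2 (sub P) ↑S.W' (S.swap.whiteLevel n).1) := by
  induction n with
  | zero => rfl
  | succ n ih =>
    have hsub : ∀ (A B : Set Triangle) (C : Finset Triangle),
        image2 (sub P) (image2 (sub P) A B) (C : Set Triangle)
          = image2 (sub P) A (image2 (sub P) B C) := fun A B C => image2_assoc (sub_assoc P)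
    have h1 : S.whiteLevel (n + 1 + 1) =
      (image2 (sub P) (S.whiteLevel (n + 1)).1 ↑S.W ∪
          image2 (sub P) (S.whiteLevel (n + 1)).2 ↑S.Y',
        image2 (sub P) (S.whiteLevel (n + 1)).1 ↑S.W' ∪
          image2 (sub P) (S.whiteLevel (n + 1)).2 ↑S.Y) := rfl
    have h2 : S.swap.whiteLevel (n + 1) =
      (image2 (sub P) (S.swap.whiteLevel n).1 ↑S.Y ∪
          image2 (sub P) (S.swap.whiteLevel n).2 ↑S.W',
        image2 (sub P) (S.swap.whiteLevel n).1 ↑S.Y' ∪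
          image2 (sub P) (S.swap.whiteLevel n).2 ↑S.W) := rfl
    have h3 : S.whiteLevel (n + 1) =
      (image2 (sub P) (S.whiteLevel n).1 ↑S.W ∪
          image2 (sub P) (S.whiteLevel n).2 ↑S.Y',
        image2 (sub P) (S.whiteLevel n).1 ↑S.W' ∪
          image2 (sub P) (S.whiteLevel n).2 ↑S.Y) := rfl
    -- Both sides become words with the first and the last letter split off, differing only in
    -- bracketing and order.
    conv_lhs => rw [h1, ih]
    conv_rhs => rw [h2, h3]
    simp only [image2_union_left, image2_union_right, hsub]
    congr 1 <;> ac_rfl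

/-- The union of the white triangles of a level. -/
def levelUnion (S : PatternsSystem P m) (n : ℕ) : Set Plane :=
  ⋃ T ∈ (S.whiteLevel n).1 ∪ (S.whiteLevel n).2, Triangle.full T

theorem levelUnion_zero (S : PatternsSystem P m) :
    S.levelUnion 0 = (⋃ T ∈ S.W, proj P T '' convexHull ℝ (range P)) ∪
      ⋃ T ∈ S.W', proj P T '' convexHull ℝ (range P) := by
  simp only [levelUnion, whiteLevel, biUnion_union, full_eq_image P, Finset.mem_coe]

theorem levelUnion_succ (S : PatternsSystem P m) (n : ℕ) :
    S.levelUnion (n + 1) = (⋃ T ∈ S.W, proj P T '' S.levelUnion n) ∪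
      ⋃ T ∈ S.W', proj P T '' S.swap.levelUnion n := by
  simp only [levelUnion, whiteLevel_succ_eq, biUnion_union, biUnion_image2, full_sub,
    image_union, image_iUnion₂, Finset.mem_coe, iUnion_union_distrib]
  ac_rfl

/-- The index shifts by one because `levelSet` starts from the full triangle, `whiteLevel` from the
patterns. Both colours are needed at once since the recursion mixes them. -/
theorem levelSet_white_yellow (S : PatternsSystem P m) (n : ℕ) :
    S.gifs.levelSet (convexHull ℝ (range P)) (n + 1) .white = S.levelUnion n ∧
      S.gifs.levelSet (convexHull ℝ (range P)) (n + 1) .yellow = S.swap.levelUnion n := by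
  induction n with
  | zero =>
    rw [levelUnion_zero, levelUnion_zero]
    exact ⟨S.iUnion_edge_white _, S.iUnion_edge_yellow _⟩
  | succ n ih =>
    rw [levelUnion_succ, levelUnion_succ, ← ih.1, ← ih.2, show S.swap.swap = S from rfl, ← ih.1]
    exact ⟨S.iUnion_edge_white _, S.iUnion_edge_yellow _⟩

theorem image_map_triangle_subset (S : PatternsSystem P m) (e : Edge S) :
    S.gifs.map e '' convexHull ℝ (range P) ⊆ convexHull ℝ (range P) := by
  obtain ⟨T, hT, he⟩ := S.exists_map_eq_proj e
  rw [he]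
  exact image_proj_triangle_subset hT

theorem fractals_eq_iInter_levelSet (S : PatternsSystem P m) :
    S.fractals = fun v => ⋂ n, S.gifs.levelSet (convexHull ℝ (range P)) n v := by
  funext v
  have hanti := GraphDirectedIFS.levelSet_antitone S.image_map_triangle_subset v
  have h1 : ⋂ n, S.gifs.levelSet (convexHull ℝ (range P)) n v
      = ⋂ n, S.gifs.levelSet (convexHull ℝ (range P)) (n + 1) v :=
    (subset_iInter fun n => iInter_subset _ _).antisymm
      (iInter_mono fun n => hanti n.le_succ)
  rw [h1]
  cases v with
  | white => exact iInter_congr fun n => (S.levelSet_white_yellow n).1.symm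
  | yellow => exact iInter_congr fun n => (S.levelSet_white_yellow n).2.symm

theorem isInvariantFamily_fractals (S : PatternsSystem P m) (hm : 2 ≤ m) (hW' : S.W'.Nonempty)
    (hY' : S.Y'.Nonempty) : S.gifs.IsInvariantFamily S.fractals := by
  have hr := S.isSimilarWithRatio hm
  rw [fractals_eq_iInter_levelSet]
  refine GraphDirectedIFS.isInvariantFamily_iInter_levelSet isCompact_triangle
    ((range_nonempty P).convexHull) (fun e => (hr.lipschitzWith e).continuous) hr.injective
    S.image_map_triangle_subset ?_
  rintro (_ | _)
  · exact ⟨.ofW' ⟨_, hW'.choose_spec⟩, rfl⟩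
  · exact ⟨.ofY' ⟨_, hY'.choose_spec⟩, rfl⟩

/-! ### The growth rate -/

/-- The characteristic equation of the edge-counting matrix. -/
theorem growthRate_mul_self (S : PatternsSystem P m) :
    (S.growthRate - S.W.card) * (S.growthRate - S.Y.card) = S.W'.card * S.Y'.card := by
  have h := Real.mul_self_sqrt (show (0 : ℝ) ≤ ((S.W.card : ℝ) - S.Y.card) ^ 2
    + 4 * S.W'.card * S.Y'.card by positivity)
  rw [growthRate]
  linear_combination h / 4

theorem card_lt_growthRate (S : PatternsSystem P m) (hW' : S.W'.Nonempty) (hY' : S.Y'.Nonempty) :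
    (S.W.card : ℝ) < S.growthRate := by
  have h1 : (0 : ℝ) < S.W'.card := Nat.cast_pos.2 hW'.card_pos
  have h2 : (0 : ℝ) < S.Y'.card := Nat.cast_pos.2 hY'.card_pos
  have h3 : (S.W.card : ℝ) - S.Y.card <
      √(((S.W.card : ℝ) - S.Y.card) ^ 2 + 4 * S.W'.card * S.Y'.card) :=
    Real.lt_sqrt_of_sq_lt (lt_add_of_pos_right _ (by positivity))
  rw [growthRate]
  linarith

theorem one_le_growthRate (S : PatternsSystem P m) (hW' : S.W'.Nonempty) (hY' : S.Y'.Nonempty) :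
    1 ≤ S.growthRate := by
  have h1 : (1 : ℝ) ≤ S.W'.card := Nat.one_le_cast.2 hW'.card_pos
  have h2 : (1 : ℝ) ≤ S.Y'.card := Nat.one_le_cast.2 hY'.card_pos
  have h3 : (2 : ℝ) ≤ √(((S.W.card : ℝ) - S.Y.card) ^ 2 + 4 * S.W'.card * S.Y'.card) := by
    refine Real.le_sqrt_of_sq_le ?_
    nlinarith [sq_nonneg ((S.W.card : ℝ) - S.Y.card), mul_nonneg (sub_nonneg.2 h1)
      (sub_nonneg.2 h2)]
  rw [growthRate]
  linarith [S.W.card.cast_nonneg (α := ℝ), S.Y.card.cast_nonneg (α := ℝ)]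

theorem dimension_fractals (S : PatternsSystem P m) (hm : 2 ≤ m) (hW' : S.W'.Nonempty)
    (hY' : S.Y'.Nonempty) (v : Vertex) :
    dimH (S.fractals v) = ENNReal.ofReal (Real.log S.growthRate / Real.log m) ∧
      HasBoxDim (S.fractals v) (Real.log S.growthRate / Real.log m) := by
  -- `(|W'|, λ - |W|)` solves the white eigenvector equation identically and the yellow one by the
  -- characteristic equation; its entries are positive because `W'` and `Y'` are non-empty.
  obtain ⟨h, hw, hy⟩ : ∃ h : Vertex → ℝ, h .white = S.W'.card ∧
      h .yellow = S.growthRate - S.W.card :=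
    ⟨fun v => match v with
      | .white => (S.W'.card : ℝ)
      | .yellow => S.growthRate - S.W.card, rfl, rfl⟩
  have key := GraphDirectedIFS.dimension_eq_of_openSetCondition (h := h)
    (S.isSimilarWithRatio hm) (S.isInvariantFamily_fractals hm hW' hY')
    (S.openSetCondition (by omega)) ?_ (S.one_le_growthRate hW' hY') ?_ v
  · rwa [one_div, Real.log_inv, neg_neg] at key
  · rintro (_ | _)
    · rw [hw]
      exact Nat.cast_pos.2 hW'.card_pos
    · rw [hy]
      exact sub_pos.2 (S.card_lt_growthRate hW' hY')
  · rintro (_ | _)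
    · rw [sum_edge_white, hw, hy]
      ring
    · rw [sum_edge_yellow, hw, hy]
      linear_combination -S.growthRate_mul_self

end PatternsSystem

end TriangularLabyrinth

end

theorem proposition4p3
    (P : AffineBasis (Fin 3) ℝ TriangularLabyrinth.Plane) (m : ℕ) (hm : 2 ≤ m)
    (S : TriangularLabyrinth.PatternsSystem P m)
    (hW' : S.W'.Nonempty) (hY' : S.Y'.Nonempty) :
    -- the fractals are the attractor of a two-vertex graph-directed IFS with the OSC
    (S.gifs.IsSimilarWithRatio (1 / (m : ℝ)) ∧
      S.gifs.OpenSetCondition ∧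
      S.gifs.IsAttractor S.fractals) ∧
    -- the set equations, written out
    (S.whiteFractal =
        (⋃ T ∈ S.W, TriangularLabyrinth.proj P T '' S.whiteFractal) ∪
          ⋃ T ∈ S.W', TriangularLabyrinth.proj P T '' S.yellowFractal) ∧
    (S.yellowFractal =
        (⋃ T ∈ S.Y, TriangularLabyrinth.proj P T '' S.yellowFractal) ∪
          ⋃ T ∈ S.Y', TriangularLabyrinth.proj P T '' S.whiteFractal) ∧
    -- the dimensions
    dimH S.whiteFractal = ENNReal.ofReal (Real.log S.growthRate / Real.log m) ∧
    dimH S.yellowFractal = ENNReal.ofReal (Real.log S.growthRate / Real.log m) ∧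
    HasBoxDim S.whiteFractal (Real.log S.growthRate / Real.log m) ∧
    HasBoxDim S.yellowFractal (Real.log S.growthRate / Real.log m) := by
  have hr := S.isSimilarWithRatio hm
  have hK := S.isInvariantFamily_fractals hm hW' hY'
  have hw := S.dimension_fractals hm hW' hY' .white
  have hy := S.dimension_fractals hm hW' hY' .yellow
  exact ⟨⟨hr, S.openSetCondition (by omega), hK.isAttractor hr⟩,
    (hK.2 .white).trans (S.iUnion_edge_white _), (hK.2 .yellow).trans (S.iUnion_edge_yellow _),
    hw.1, hy.1, hw.2, hy.2⟩
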